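/- **Online service with deadlines.** A server moves in a finite metric space $X$ with $n\ge 1$ points, starting from a given point $s$; its movements are instantaneous. The input is a finite collection of requests; a request $q$ is located at a point of $X$ (also denoted $q$), is revealed at its release time $r_q$, and has a deadline $d_q\ge r_q$. A feasible solution moves the server so that for every request $q$ the server is at the point $q$ at some time in $[r_q,d_q]$; its cost is the total distance moved. A deterministic online algorithm must determine its movements up to each time $t$ from $X$, $s$ and the requests released up to time $t$ only. It is $\rho$-competitive if on every input it produces a feasible solution of cost at most $\rho$ times the cost of every feasible solution with the same starting point. **Theorem.** There is an absolute constant $C$ such that for every $n$-point metric space there is a deterministic online algorithm for online service with deadlines that is $(C\log n)$-competitive. More precisely, the following algorithm is one, for every 2-approximation procedure $\mathrm{ST}$ for the Steiner tree problem (given a set $U$ of points and an $r \in U$, the procedure returns a tree, rooted at $r$, that spans $U$, possibly through further points, and whose total edge length is at most twice the minimum). **Algorithm.** Each request $q$ has a level $\ell_q$, initially $-\infty$; when the server is at $a$, its adjusted level is $\tilde\ell_q=\max(\ell_q,\lceil\log_2 d(a,q)\rceil)$, where $\log_2 0=-\infty$ and $2^{-\infty}=0$. A request is pending if it has been released and has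 not been chosen in an earlier service. Whenever a pending request $q$ reaches its deadline (equal deadlines are ordered by their position in the input, here and below, and requests released at that same time are taken into account), a service is performed, as follows, with $a$ the current location of the server: 1. The service is called primary if $\tilde\ell_q\ne\ell_q$. Its level is $L=\tilde\ell_q+3$. The pending requests $q'$ with $\tilde\ell_{q'}\le L$ are eligible. 2. Let $R$ be the set of chosen requests. The eligible requests are added to $R$ one by one in the order of increasing deadlines, beginning with $q$, until all are chosen or the cost of $\mathrm{ST}(R)$, rooted at $q$, is at least $4\cdot 2^{L}$. 3. The server performs a depth-first tour of $\mathrm{ST}(R)$, starting and ending at $q$, which serves $R$, and returns to $a$. The level of every eligible request that was not chosen is set to $L+1$. If the service is primary, the server then moves to $q$. -/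

import Mathlib

namespace OnlineService

/-! ## Online service with deadlines on a metric space -/

/-- A request on a point, to be served within the closed time interval `[release, deadline]`. -/
structure Request (X : Type*) where
  point : X
  release : ℝ
  deadline : ℝ
  release_le_deadline : release ≤ deadline

/-- An input: finitely many requests.  Repetitions, several requests released at the same time and
equal deadlines are all allowed. -/
abbrev Instance (X : Type*) := List (Request X)

/-- The list of the (instantaneous) moves of the server, in the order in which they are made;
`(t, x)` means that at time `t` the server moves to `x`, where it stays until its next move.
Several moves may be made at the same time. -/
abbrev Schedule (X : Type*) := List (ℝ × X)

/-- The length of the walk that starts at `s` and visits the points of the list in their order. -/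
noncomputable def walkLength {X : Type*} [MetricSpace X] : X → List X → ℝ
  | _, [] => 0
  | s, x :: l => dist s x + walkLength x l

namespace Schedule

/-- Total movement of a server that is initially at `s`. -/
noncomputable def cost {X : Type*} [MetricSpace X] (s : X) (σ : Schedule X) : ℝ :=
  walkLength s (σ.map Prod.snd)

/-- A server that is initially at `s` and follows `σ` is at `x` at some moment of time `t`: this is
its position after some initial part of the moves, all made no later than `t`, while
all remaining moves are made no earlier than `t`. -/
def IsAt {X : Type*} (s : X) (σ : Schedule X) (t : ℝ) (x : X) : Prop :=
  ∃ σ₁ σ₂ : Schedule X, σ = σ₁ ++ σ₂ ∧ (∀ m ∈ σ₁, m.1 ≤ t) ∧ (∀ m ∈ σ₂, t ≤ m.1) ∧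
    (σ₁.map Prod.snd).getLastD s = x

/-- The request is served: the server is at its point at some time of its interval. -/
def Serves {X : Type*} (s : X) (σ : Schedule X) (q : Request X) : Prop :=
  ∃ t : ℝ, q.release ≤ t ∧ t ≤ q.deadline ∧ IsAt s σ t q.point

/-- The moves are listed in chronological order and all requests are served in time. -/
def IsFeasible {X : Type*} (s : X) (I : Instance X) (σ : Schedule X) : Prop :=
  σ.Pairwise (fun m m' => m.1 ≤ m'.1) ∧ ∀ q ∈ I, Serves s σ q

end Schedule

/-- A deterministic algorithm: from the initial location of the server and the requests
it determines the moves of the server.  That it is online is the predicate `IsOnline`. -/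
abbrev Algorithm (X : Type*) := X → Instance X → Schedule X

namespace Algorithm

open Classical in
/-- The moves made up to any time `t` depend only on the requests released up to `t`. -/
def IsOnline {X : Type*} (A : Algorithm X) : Prop :=
  ∀ (s : X) (I I' : Instance X) (t : ℝ),
    I.filter (fun q => q.release ≤ t) = I'.filter (fun q => q.release ≤ t) →
    (A s I).filter (fun m => m.1 ≤ t) = (A s I').filter (fun m => m.1 ≤ t)

/-- On every input the algorithm serves all requests in time, at a cost of at most `ρ` times the
cost of every feasible (offline) solution from the same initial location. -/
def IsCompetitive {X : Type*} [MetricSpace X] (A : Algorithm X) (ρ : ℝ) : Prop :=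
  ∀ (s : X) (I : Instance X), Schedule.IsFeasible s I (A s I) ∧
    ∀ σ : Schedule X, Schedule.IsFeasible s I σ →
      Schedule.cost s (A s I) ≤ ρ * Schedule.cost s σ

end Algorithm

/-! ## Steiner trees -/

/-- Rooted ordered trees with vertices labelled by points: `single x` is a one-vertex tree, and
`graft S T` is `S` with `T` hung below the root of `S` as its last subtree. -/
inductive RTree (X : Type*) where
  | single (x : X) : RTree X
  | graft (S T : RTree X) : RTree X

namespace RTree

def root {X : Type*} : RTree X → X
  | single x => x
  | graft S _ => S.root

def points {X : Type*} : RTree X → Set X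
  | single x => {x}
  | graft S T => S.points ∪ T.points

/-- The total length of the edges. -/
noncomputable def cost {X : Type*} [MetricSpace X] : RTree X → ℝ
  | single _ => 0
  | graft S T => S.cost + dist S.root T.root + T.cost

/-- The depth-first tour, from the root back to the root, along every edge once in each
direction. -/
def tour {X : Type*} : RTree X → List X
  | single x => [x]
  | graft S T => S.tour ++ T.tour ++ [S.root]

end RTree

/-- A procedure for the Steiner tree problem: given a set `U` of terminals and one of
them, `r`, it returns a tree, rooted at `r`. -/
abbrev SteinerProcedure (X : Type*) := X → Set X → RTree X

/-- The tree returned spans the terminals and costs at most twice as much as any tree that does. -/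
def SteinerProcedure.IsTwoApprox {X : Type*} [MetricSpace X] (ST : SteinerProcedure X) : Prop :=
  ∀ (U : Set X) (r : X), r ∈ U → (ST r U).root = r ∧ U ⊆ (ST r U).points ∧
    ∀ T : RTree X, U ⊆ T.points → (ST r U).cost ≤ 2 * T.cost

/-! ## The algorithm -/

/-- Levels of requests and of services; `⊥` is the level `-∞`. -/
abbrev Level := WithBot ℤ

/-- `2 ^ ℓ`, where `2 ^ (-∞) = 0`. -/
noncomputable def Level.pow (ℓ : Level) : ℝ := WithBot.recBotCoe 0 (fun k : ℤ => (2 : ℝ) ^ k) ℓ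

open Classical in
/-- `⌈log₂ d(a, x)⌉`, where `log₂ 0 = -∞`. -/
noncomputable def distLevel {X : Type*} [MetricSpace X] (a x : X) : Level :=
  if dist a x = 0 then ⊥ else ((⌈Real.logb 2 (dist a x)⌉ : ℤ) : Level)

/-- A request that has not been served by the algorithm yet, with its current level. -/
structure Job (X : Type*) where
  req : Request X
  level : Level

/-- The adjusted level of a request when the server is at `a`. -/
noncomputable def Job.adjLevel {X : Type*} [MetricSpace X] (a : X) (j : Job X) : Level :=
  max j.level (distLevel a j.req.point)

/-- At time `t`, with the server at `a`, the request is pending (it is released) and its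
adjusted level is at most that of the service, `L`. -/
def Job.IsEligible {X : Type*} [MetricSpace X] (a : X) (t : ℝ) (L : Level) (j : Job X) : Prop :=
  j.req.release ≤ t ∧ j.adjLevel a ≤ L

open Classical in
/-- The loop over the other requests in a service of level `L` at time `t`, with the server at `a`,
triggered by a request on `q`.  `R` is the set of the points of the requests chosen so far, and the
list holds the remaining unserved requests in the order of their deadlines.  An eligible request is
chosen as long as the Steiner tree on `R` costs less than `4 * 2 ^ L`; the eligible requests that
remain get level `L + 1`; requests that are not eligible are left as they are.
The result is the final `R` and the list of the requests that were not chosen. -/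
noncomputable def chooseRequests {X : Type*} [MetricSpace X] (ST : SteinerProcedure X)
    (a : X) (t : ℝ) (L : Level) (q : X) : Set X → List (Job X) → Set X × List (Job X)
  | R, [] => (R, [])
  | R, j :: js =>
    if j.IsEligible a t L then
      if 4 * L.pow ≤ (ST q R).cost then
        let out := chooseRequests ST a t L q R js
        (out.1, { j with level := L + ((1 : ℤ) : Level) } :: out.2)
      else
        chooseRequests ST a t L q (insert j.req.point R) js
    else
      let out := chooseRequests ST a t L q R js
      (out.1, j :: out.2)

/-- The state of the algorithm: the location of the server, the requests that are not yet served in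
the order of their deadlines (a request that is not yet released is not looked at and has its
initial level `⊥`), and the moves made so far. -/
structure State (X : Type*) where
  pos : X
  jobs : List (Job X)
  moves : Schedule X

open Classical in
/-- The service triggered by the deadline of the first unserved request `j`.  The server, which is
at `a`, performs the depth-first tour of the Steiner tree on the chosen requests, returns to `a`
and, if the service is primary, then moves to the triggering request. -/
noncomputable def service {X : Type*} [MetricSpace X] (ST : SteinerProcedure X)
    (S : State X) : State X :=
  match S.jobs with
  | [] => S
  | j :: js =>
    let a := S.pos
    let q := j.req.point
    let t := j.req.deadline
    let L : Level := j.adjLevel a + ((3 : ℤ) : Level)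
    let out := chooseRequests ST a t L q {q} js
    let final : X := if j.adjLevel a ≠ j.level then q else a
    { pos := final
      jobs := out.2
      moves := S.moves ++ ((ST q out.1).tour ++ [a, final]).map (fun x => (t, x)) }

open Classical in
/-- Requests are sorted by deadline, ties being broken by their order in the input; then services
are performed until all requests are served (each serves at least one request). -/
noncomputable def serviceAlgorithm {X : Type*} [MetricSpace X] (ST : SteinerProcedure X) :
    Algorithm X := fun s I =>
  ((service ST)^[I.length]
    { pos := s
      jobs := (I.insertionSort (fun q q' => q.deadline ≤ q'.deadline)).map (fun q => ⟨q, ⊥⟩)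
      moves := [] }).moves

end OnlineService

/-!
The cost of a service of level `L` is at most `23 * 2 ^ L`, so that it suffices to bound the sum of
the `2 ^ L` by `O(log n)` times the cost of any offline schedule `σ`.

*Disjointness.* A job that is eligible for a service of level `L` but not chosen gets the level
`L + 1`.  Hence a job that still has a level of at most `L` later on was not yet released, or was at
distance more than `2 ^ L` (`Run.pow_level_lt_dist`).  So the triggers of two services of the same
level are far apart, or that of the later service was released after the earlier one
(`Run.time_lt_release`).

*Boxes.* A service is charged to the moves of `σ` that start in a ball of radius `2 ^ L / 4` around
its trigger, between the first service by `σ` of certain requests and the time of the service.  By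
disjointness these boxes do not overlap for services of the same level.  For a primary service the
only request is the trigger, and `σ` moves far enough in the box if its server is away from the
trigger at the time of the service (`Run.exists_start_of_isPrimary`).  For a secondary service, the
trigger was left over by a service of level `L - 4`, because the tree on the requests chosen there
was expensive; these requests are near, have earlier deadlines, and make `σ` move far
(`Run.exists_start_of_not_isPrimary`).  A primary service that finds the offline server near the
trigger is paid for by the distance between the two servers (`Run.sum_not_charged_add_dist_le`).

*The logarithm.* Moves that are much shorter than `2 ^ L / n` can be ignored in a box of level `L`:
the first arrivals of a walk at its points form a tree with fewer than `n` edges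
(`RTree.exists_tree_of_walk`).  A move of length `d` therefore counts fully only for the `O(log n)`
levels with `d ≤ 2 ^ L ≤ O(n d)`, and as a geometric series for the lower levels
(`sum_moveWeight_le`, `sum_zpow_le_of_disjoint`).

The algorithm is online because jobs released after time `t` have no influence on the services up
to time `t`, and sorting by deadline is stable (`filter_serviceAlgorithm`).
-/

namespace OnlineService

variable {X : Type*}

/-! ### Levels -/

namespace Level

@[simp] lemma pow_bot : Level.pow ⊥ = 0 := rfl

@[simp] lemma pow_coe (k : ℤ) : Level.pow (k : Level) = (2 : ℝ) ^ k := rfl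

lemma pow_nonneg (l : Level) : 0 ≤ l.pow := by
  induction l using WithBot.recBotCoe with
  | bot => simp
  | coe k => rw [pow_coe]; positivity

lemma pow_add_coe (l : Level) (k : ℤ) : (l + (k : Level)).pow = l.pow * 2 ^ k := by
  induction l using WithBot.recBotCoe with
  | bot => simp
  | coe m =>
    rw [← WithBot.coe_add, pow_coe, pow_coe, zpow_add₀ two_ne_zero]

lemma le_add_coe (l : Level) {k : ℤ} (hk : 0 ≤ k) : l ≤ l + (k : Level) := by
  induction l using WithBot.recBotCoe with
  | bot => simp
  | coe m => rw [← WithBot.coe_add, WithBot.coe_le_coe]; omega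

lemma not_add_one_le {l : Level} (hl : l ≠ ⊥) : ¬ l + ((1 : ℤ) : Level) ≤ l := by
  induction l using WithBot.recBotCoe with
  | bot => simp at hl
  | coe m => rw [← WithBot.coe_add, WithBot.coe_le_coe]; omega

end Level

lemma distLevel_le_iff [MetricSpace X] (a x : X) (l : Level) :
    distLevel a x ≤ l ↔ dist a x ≤ l.pow := by
  unfold distLevel
  split_ifs with h
  · simp [h, Level.pow_nonneg]
  · have hpos : 0 < dist a x := lt_of_le_of_ne dist_nonneg (Ne.symm h)
    induction l using WithBot.recBotCoe with
    | bot => simpa using hpos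
    | coe k =>
      rw [WithBot.coe_le_coe, Int.ceil_le, Level.pow_coe,
        Real.logb_le_iff_le_rpow one_lt_two hpos, Real.rpow_intCast]

lemma Job.isEligible_iff [MetricSpace X] {a : X} {t : ℝ} {l : Level} {j : Job X} :
    j.IsEligible a t l ↔ j.req.release ≤ t ∧ j.level ≤ l ∧ dist a j.req.point ≤ l.pow := by
  rw [Job.IsEligible, Job.adjLevel, max_le_iff, distLevel_le_iff]

lemma Job.dist_le_pow_adjLevel [MetricSpace X] (a : X) (j : Job X) :
    dist a j.req.point ≤ (j.adjLevel a).pow :=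
  (distLevel_le_iff _ _ _).1 (le_max_right _ _)

/-! ### Trees -/

namespace RTree

lemma root_mem_points (T : RTree X) : T.root ∈ T.points := by
  induction T with
  | single x => exact rfl
  | graft S T ihS _ => exact Or.inl ihS

lemma points_finite (T : RTree X) : T.points.Finite := by
  induction T with
  | single x => exact Set.finite_singleton x
  | graft S T ihS ihT => exact ihS.union ihT

lemma tour_ne_nil (T : RTree X) : T.tour ≠ [] := by
  cases T <;> simp [tour]

lemma mem_tour {T : RTree X} {x : X} (h : x ∈ T.points) : x ∈ T.tour := by
  induction T with
  | single y => simpa [tour, points] using h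
  | graft S T ihS ihT =>
    rcases h with h | h
    · simp [tour, ihS h]
    · simp [tour, ihT h]

lemma getLastD_tour (T : RTree X) (s : X) : T.tour.getLastD s = T.root := by
  cases T <;> simp [tour, root, List.getLastD_eq_getLast?]

variable [MetricSpace X]

lemma cost_nonneg (T : RTree X) : 0 ≤ T.cost := by
  induction T with
  | single x => exact le_rfl
  | graft S T ihS ihT => exact add_nonneg (add_nonneg ihS dist_nonneg) ihT

lemma dist_root_le_cost (T : RTree X) {x : X} (h : x ∈ T.points) : dist T.root x ≤ T.cost := by
  induction T with
  | single y => simp_all [points, root, cost]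
  | graft S T ihS ihT =>
    have := S.cost_nonneg
    have := T.cost_nonneg
    have := dist_nonneg (x := S.root) (y := T.root)
    simp only [root, cost]
    rcases h with h | h
    · linarith [ihS h]
    · linarith [ihT h, dist_triangle S.root T.root x]

lemma dist_le_cost (T : RTree X) {x y : X} (hx : x ∈ T.points) (hy : y ∈ T.points) :
    dist x y ≤ T.cost := by
  induction T with
  | single z => simp_all [points, cost]
  | graft S T ihS ihT =>
    have := S.cost_nonneg
    have := T.cost_nonneg
    have := dist_nonneg (x := S.root) (y := T.root)
    simp only [cost]
    rcases hx with hx | hx <;> rcases hy with hy | hy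
    · linarith [ihS hx hy]
    · linarith [S.dist_root_le_cost hx, T.dist_root_le_cost hy, dist_triangle4 x S.root T.root y,
        dist_comm x S.root]
    · linarith [S.dist_root_le_cost hy, T.dist_root_le_cost hx, dist_triangle4 y S.root T.root x,
        dist_comm y S.root, dist_comm x y]
    · linarith [ihT hx hy]

/-- A tree can be hung below any vertex of another one. -/
lemma exists_attach (S T : RTree X) {y : X} (hy : y ∈ S.points) :
    ∃ S' : RTree X, S'.root = S.root ∧ S'.points = S.points ∪ T.points ∧
      S'.cost = S.cost + dist y T.root + T.cost := by
  induction S with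
  | single z =>
    obtain rfl : y = z := hy
    exact ⟨graft (single y) T, rfl, rfl, rfl⟩
  | graft A B ihA ihB =>
    rcases hy with hy | hy
    · obtain ⟨A', h1, h2, h3⟩ := ihA hy
      refine ⟨graft A' B, h1, ?_, ?_⟩
      · simp only [points, h2, Set.union_right_comm]
      · simp only [cost, h1, h3]; ring
    · obtain ⟨B', h1, h2, h3⟩ := ihB hy
      refine ⟨graft A B', rfl, ?_, ?_⟩
      · simp only [points, h2, Set.union_assoc]
      · simp only [cost, h1, h3]; ring

lemma exists_reroot (T : RTree X) {r : X} (hr : r ∈ T.points) :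
    ∃ T' : RTree X, T'.root = r ∧ T'.points = T.points ∧ T'.cost = T.cost := by
  induction T with
  | single z => exact ⟨single z, (show r = z from hr).symm, rfl, rfl⟩
  | graft A B ihA ihB =>
    rcases hr with hr | hr
    · obtain ⟨A', h1, h2, h3⟩ := ihA hr
      obtain ⟨T', g1, g2, g3⟩ := exists_attach A' B (h2 ▸ A.root_mem_points)
      exact ⟨T', g1.trans h1, by rw [g2, h2]; rfl, by rw [g3, h3]; rfl⟩
    · obtain ⟨B', h1, h2, h3⟩ := ihB hr
      obtain ⟨T', g1, g2, g3⟩ := exists_attach B' A (h2 ▸ B.root_mem_points)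
      refine ⟨T', g1.trans h1, by rw [g2, h2, Set.union_comm]; rfl, ?_⟩
      rw [g3, h3, dist_comm]; simp only [cost]; ring

lemma exists_subset_points [Finite X] (r : X) (U : Set X) : ∃ T : RTree X, U ⊆ T.points := by
  induction U, U.toFinite using Set.Finite.induction_on with
  | empty => exact ⟨single r, Set.empty_subset _⟩
  | insert _ _ ih =>
    rename_i x U _ _
    obtain ⟨T, hT⟩ := ih
    obtain ⟨T', -, h, -⟩ := exists_attach T (single x) T.root_mem_points
    refine ⟨T', ?_⟩
    rw [h]
    exact Set.insert_subset (Or.inr rfl) (hT.trans Set.subset_union_left)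

/-- The tree formed by the first arrivals of a walk at its points has at most `card X - 1` edges,
so that its edges shorter than `ε` have total length at most `ε * card X`, while each of the others
is a move of the walk. -/
lemma exists_tree_of_walk [Fintype X] (p : ℕ → X) {ε : ℝ} (hε : 0 ≤ ε) (u e : ℕ) (hue : u ≤ e) :
    ∃ T : RTree X, (∀ i, u ≤ i → i ≤ e → p i ∈ T.points) ∧
      T.cost ≤ (∑ i ∈ Finset.Ico u e, if ε ≤ dist (p i) (p (i + 1)) then dist (p i) (p (i + 1))
        else 0) + ε * Fintype.card X := by
  -- The number of points is the extra information that makes the induction go through.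
  suffices h : ∃ T : RTree X, (∀ i, u ≤ i → i ≤ e → p i ∈ T.points) ∧
      T.cost ≤ (∑ i ∈ Finset.Ico u e, if ε ≤ dist (p i) (p (i + 1)) then dist (p i) (p (i + 1))
        else 0) + ε * T.points.ncard by
    obtain ⟨T, h1, h2⟩ := h
    refine ⟨T, h1, h2.trans ?_⟩
    gcongr
    rw [← Nat.card_eq_fintype_card]
    exact Set.ncard_le_card _
  induction e, hue using Nat.le_induction with
  | base =>
    refine ⟨single (p u), fun i h1 h2 => ?_, ?_⟩
    · obtain rfl : i = u := le_antisymm h2 h1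
      exact rfl
    · simp only [cost, Finset.Ico_self, Finset.sum_empty, zero_add]
      positivity
  | succ e hue ih =>
    obtain ⟨T, h1, h2⟩ := ih
    rw [Finset.sum_Ico_succ_top hue]
    by_cases hmem : p (e + 1) ∈ T.points
    · refine ⟨T, fun i hi hi' => ?_, h2.trans ?_⟩
      · rcases hi'.lt_or_eq with h | rfl
        · exact h1 i hi (by omega)
        · exact hmem
      · have : 0 ≤ if ε ≤ dist (p e) (p (e + 1)) then dist (p e) (p (e + 1)) else 0 := by
          split_ifs <;> positivity
        linarith
    · obtain ⟨T', -, g2, g3⟩ := exists_attach T (single (p (e + 1))) (h1 e hue le_rfl)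
      refine ⟨T', fun i hi hi' => ?_, ?_⟩
      · rw [g2]
        rcases hi'.lt_or_eq with h | rfl
        · exact Or.inl (h1 i hi (by omega))
        · exact Or.inr rfl
      · have hcard : T'.points.ncard = T.points.ncard + 1 := by
          rw [g2, ← Set.ncard_insert_of_notMem hmem T.points_finite, ← Set.union_singleton]
          rfl
        rw [g3, hcard]
        push_cast
        simp only [root, cost]
        split_ifs with h
        · nlinarith
        · nlinarith

end RTree

lemma exists_isTwoApprox [Finite X] [MetricSpace X] :
    ∃ ST : SteinerProcedure X, ST.IsTwoApprox := by
  suffices h : ∀ (r : X) (U : Set X), ∃ T : RTree X, r ∈ U → T.root = r ∧ U ⊆ T.points ∧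
      ∀ T' : RTree X, U ⊆ T'.points → T.cost ≤ 2 * T'.cost by
    choose ST hST using h
    exact ⟨ST, fun U r hr => hST r U hr⟩
  intro r U
  by_cases hU : ∃ x ∈ U, ∃ y ∈ U, x ≠ y
  · obtain ⟨x, hx, y, hy, hxy⟩ := hU
    -- The infimum of the costs is positive here, so that some tree is within a factor 2 of it.
    set c : ℝ := sInf (RTree.cost '' {T : RTree X | U ⊆ T.points})
    have hne : (RTree.cost '' {T : RTree X | U ⊆ T.points}).Nonempty :=
      let ⟨T, hT⟩ := RTree.exists_subset_points r U
      ⟨T.cost, T, hT, rfl⟩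
    have hpos : 0 < c := (dist_pos.2 hxy).trans_le <| le_csInf hne <| by
      rintro _ ⟨T, hT, rfl⟩
      exact T.dist_le_cost (hT hx) (hT hy)
    obtain ⟨_, ⟨T, hT, rfl⟩, hlt⟩ := exists_lt_of_csInf_lt hne (show c < 2 * c by linarith)
    by_cases hr : r ∈ U
    · obtain ⟨T', h1, h2, h3⟩ := T.exists_reroot (hT hr)
      refine ⟨T', fun _ => ⟨h1, h2 ▸ hT, fun T'' hT'' => ?_⟩⟩
      have : c ≤ T''.cost := csInf_le ⟨0, by rintro _ ⟨T, -, rfl⟩; exact T.cost_nonneg⟩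
        ⟨T'', hT'', rfl⟩
      linarith
    · exact ⟨T, fun h => absurd h hr⟩
  · push Not at hU
    refine ⟨.single r, fun hr => ⟨rfl, fun x hx => hU x hx r hr, fun T' _ => ?_⟩⟩
    have := T'.cost_nonneg
    simp only [RTree.cost]
    linarith

/-! ### Walks -/

section Walk

variable [MetricSpace X]

lemma walkLength_append (s : X) (l l' : List X) :
    walkLength s (l ++ l') = walkLength s l + walkLength (l.getLastD s) l' := by
  induction l generalizing s with
  | nil => simp [walkLength]
  | cons x l ih =>
    simp only [List.cons_append, walkLength, ih, List.getLastD_cons]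
    ring

omit [MetricSpace X] in
lemma getLastD_append_of_ne_nil {l' : List X} (h : l' ≠ []) (l : List X) (s : X) :
    (l ++ l').getLastD s = l'.getLastD s := by
  simp [List.getLastD_eq_getLast?, List.getLast?_append_of_ne_nil _ h]

lemma RTree.walkLength_tour (T : RTree X) (a : X) :
    walkLength a T.tour = dist a T.root + 2 * T.cost := by
  induction T generalizing a with
  | single x => simp [walkLength, tour, root, cost]
  | graft S T ihS ihT =>
    simp only [tour, walkLength_append, ihS, ihT, getLastD_append_of_ne_nil T.tour_ne_nil,
      getLastD_tour, walkLength, root, cost, dist_comm T.root S.root]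
    ring

end Walk

/-! ### A single service -/

/-- A list of jobs is sorted by deadline. -/
def SortedJobs (js : List (Job X)) : Prop :=
  (js.map Job.req).Pairwise fun q q' => q.deadline ≤ q'.deadline

lemma SortedJobs.le {j : Job X} {js : List (Job X)} (h : SortedJobs (j :: js)) {i : Job X}
    (hi : i ∈ js) : j.req.deadline ≤ i.req.deadline :=
  (List.pairwise_cons.1 h).1 _ (List.mem_map_of_mem hi)

lemma SortedJobs.tail {j : Job X} {js : List (Job X)} (h : SortedJobs (j :: js)) :
    SortedJobs js :=
  (List.pairwise_cons.1 h).2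

section Choose

variable [MetricSpace X] {ST : SteinerProcedure X} {a : X} {t : ℝ} {L : Level} {q : X}

lemma chooseRequests_of_not_isEligible {R : Set X} {j : Job X} {js : List (Job X)}
    (h : ¬ j.IsEligible a t L) :
    chooseRequests ST a t L q R (j :: js) = ((chooseRequests ST a t L q R js).1,
      j :: (chooseRequests ST a t L q R js).2) := by
  rw [chooseRequests, if_neg h]

lemma chooseRequests_of_full {R : Set X} {j : Job X} {js : List (Job X)}
    (h : j.IsEligible a t L) (hR : 4 * L.pow ≤ (ST q R).cost) :
    chooseRequests ST a t L q R (j :: js) = ((chooseRequests ST a t L q R js).1,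
      { j with level := L + ((1 : ℤ) : Level) } :: (chooseRequests ST a t L q R js).2) := by
  rw [chooseRequests, if_pos h, if_pos hR]

lemma chooseRequests_of_not_full {R : Set X} {j : Job X} {js : List (Job X)}
    (h : j.IsEligible a t L) (hR : ¬ 4 * L.pow ≤ (ST q R).cost) :
    chooseRequests ST a t L q R (j :: js) =
      chooseRequests ST a t L q (insert j.req.point R) js := by
  rw [chooseRequests, if_pos h, if_neg hR]

/-- An induction principle that follows the three branches of `chooseRequests`. -/
lemma chooseRequests_induction {ST : SteinerProcedure X} {a : X} {t : ℝ} {L : Level} {q : X}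
    {P : Set X → List (Job X) → Prop}
    (nil : ∀ R, P R [])
    (skip : ∀ R j js, ¬ j.IsEligible a t L → P R js → P R (j :: js))
    (full : ∀ R j js, j.IsEligible a t L → 4 * L.pow ≤ (ST q R).cost → P R js → P R (j :: js))
    (choose : ∀ R j js, j.IsEligible a t L → ¬ 4 * L.pow ≤ (ST q R).cost →
      P (insert j.req.point R) js → P R (j :: js)) (R : Set X) (js : List (Job X)) : P R js := by
  induction js generalizing R with
  | nil => exact nil R
  | cons j js ih =>
    by_cases h : j.IsEligible a t L
    · by_cases hR : 4 * L.pow ≤ (ST q R).cost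
      · exact full R j js h hR (ih R)
      · exact choose R j js h hR (ih _)
    · exact skip R j js h (ih R)

lemma subset_chooseRequests_fst (R : Set X) (js : List (Job X)) :
    R ⊆ (chooseRequests ST a t L q R js).1 := by
  induction R, js using chooseRequests_induction (ST := ST) (a := a) (t := t) (L := L) (q := q) with
  | nil R => exact subset_rfl
  | skip R j js h ih => rwa [chooseRequests_of_not_isEligible h]
  | full R j js h hR ih => rwa [chooseRequests_of_full h hR]
  | choose R j js h hR ih =>
    rw [chooseRequests_of_not_full h hR]
    exact (Set.subset_insert _ _).trans ih

lemma chooseRequests_fst_of_full {R : Set X} (hR : 4 * L.pow ≤ (ST q R).cost)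
    (js : List (Job X)) : (chooseRequests ST a t L q R js).1 = R := by
  induction js with
  | nil => rfl
  | cons j js ih =>
    by_cases h : j.IsEligible a t L
    · rw [chooseRequests_of_full h hR, ih]
    · rw [chooseRequests_of_not_isEligible h, ih]

lemma map_req_chooseRequests_sublist (R : Set X) (js : List (Job X)) :
    ((chooseRequests ST a t L q R js).2.map Job.req).Sublist (js.map Job.req) := by
  induction R, js using chooseRequests_induction (ST := ST) (a := a) (t := t) (L := L) (q := q) with
  | nil R => exact List.Sublist.refl _
  | skip R j js h ih => rw [chooseRequests_of_not_isEligible h]; exact ih.cons_cons _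
  | full R j js h hR ih => rw [chooseRequests_of_full h hR]; exact ih.cons_cons _
  | choose R j js h hR ih => rw [chooseRequests_of_not_full h hR]; exact ih.cons _

/-- A remaining job was not eligible and is unchanged, or was eligible and left over, in which case
the tree is expensive and all requests chosen have deadlines that are no later. -/
lemma exists_of_mem_chooseRequests_snd {R : Set X} {js : List (Job X)} (hs : SortedJobs js)
    {j' : Job X} (hj' : j' ∈ (chooseRequests ST a t L q R js).2) :
    ∃ j ∈ js, j'.req = j.req ∧ ((¬ j.IsEligible a t L ∧ j' = j) ∨
      (j.IsEligible a t L ∧ j'.level = L + ((1 : ℤ) : Level) ∧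
        4 * L.pow ≤ (ST q (chooseRequests ST a t L q R js).1).cost ∧
        ∀ x ∈ (chooseRequests ST a t L q R js).1, x ∈ R ∨
          ∃ i ∈ js, i.IsEligible a t L ∧ i.req.point = x ∧ i.req.deadline ≤ j.req.deadline)) := by
  induction R, js using chooseRequests_induction (ST := ST) (a := a) (t := t) (L := L) (q := q) with
  | nil R => simp [chooseRequests] at hj'
  | skip R j js h ih =>
    rw [chooseRequests_of_not_isEligible h] at hj' ⊢
    rcases List.mem_cons.1 hj' with rfl | hj'
    · exact ⟨j', List.mem_cons_self, rfl, Or.inl ⟨h, rfl⟩⟩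
    · obtain ⟨k, hk, hreq, hk'⟩ := ih hs.tail hj'
      refine ⟨k, List.mem_cons_of_mem _ hk, hreq, hk'.imp_right ?_⟩
      rintro ⟨h1, h2, h3, h4⟩
      exact ⟨h1, h2, h3, fun x hx => (h4 x hx).imp_right fun ⟨i, hi, h'⟩ =>
        ⟨i, List.mem_cons_of_mem _ hi, h'⟩⟩
  | full R j js h hR ih =>
    rw [chooseRequests_of_full h hR] at hj' ⊢
    rcases List.mem_cons.1 hj' with rfl | hj'
    · refine ⟨j, List.mem_cons_self, rfl, Or.inr ⟨h, rfl, ?_, fun x hx => Or.inl ?_⟩⟩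
      · rwa [chooseRequests_fst_of_full hR]
      · rwa [chooseRequests_fst_of_full hR] at hx
    · obtain ⟨k, hk, hreq, hk'⟩ := ih hs.tail hj'
      refine ⟨k, List.mem_cons_of_mem _ hk, hreq, hk'.imp_right ?_⟩
      rintro ⟨h1, h2, h3, h4⟩
      exact ⟨h1, h2, h3, fun x hx => (h4 x hx).imp_right fun ⟨i, hi, h'⟩ =>
        ⟨i, List.mem_cons_of_mem _ hi, h'⟩⟩
  | choose R j js h hR ih =>
    rw [chooseRequests_of_not_full h hR] at hj' ⊢
    obtain ⟨k, hk, hreq, hk'⟩ := ih hs.tail hj'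
    refine ⟨k, List.mem_cons_of_mem _ hk, hreq, hk'.imp_right ?_⟩
    rintro ⟨h1, h2, h3, h4⟩
    refine ⟨h1, h2, h3, fun x hx => ?_⟩
    rcases h4 x hx with (rfl | hx) | ⟨i, hi, h'⟩
    · exact Or.inr ⟨j, List.mem_cons_self, h, rfl, hs.le hk⟩
    · exact Or.inl hx
    · exact Or.inr ⟨i, List.mem_cons_of_mem _ hi, h'⟩

lemma mem_map_req_or_chosen (R : Set X) {js : List (Job X)} {j : Job X} (hj : j ∈ js) :
    j.req ∈ (chooseRequests ST a t L q R js).2.map Job.req ∨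
      (j.IsEligible a t L ∧ j.req.point ∈ (chooseRequests ST a t L q R js).1) := by
  induction R, js using chooseRequests_induction (ST := ST) (a := a) (t := t) (L := L) (q := q) with
  | nil R => simp at hj
  | skip R i js h ih =>
    rw [chooseRequests_of_not_isEligible h, List.map_cons, List.mem_cons]
    rcases List.mem_cons.1 hj with rfl | hj
    · exact Or.inl (Or.inl rfl)
    · exact (ih hj).imp_left Or.inr
  | full R i js h hR ih =>
    rw [chooseRequests_of_full h hR, List.map_cons, List.mem_cons]
    rcases List.mem_cons.1 hj with rfl | hj
    · exact Or.inl (Or.inl rfl)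
    · exact (ih hj).imp_left Or.inr
  | choose R i js h hR ih =>
    rw [chooseRequests_of_not_full h hR]
    rcases List.mem_cons.1 hj with rfl | hj
    · exact Or.inr ⟨h, subset_chooseRequests_fst _ _ (Set.mem_insert _ _)⟩
    · exact ih hj

/-- The last request is added to a tree of cost below `4 * 2 ^ L`, from which the request is at
distance at most `9 / 8 * 2 ^ L`; the approximation factor doubles the sum. -/
lemma cost_chooseRequests_le (hST : ST.IsTwoApprox) (haq : dist a q ≤ L.pow / 8) {R : Set X}
    (hq : q ∈ R) (hR : (ST q R).cost ≤ 11 * L.pow) (js : List (Job X)) :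
    (ST q (chooseRequests ST a t L q R js).1).cost ≤ 11 * L.pow := by
  induction R, js using chooseRequests_induction (ST := ST) (a := a) (t := t) (L := L) (q := q) with
  | nil R => exact hR
  | skip R j js h ih => rw [chooseRequests_of_not_isEligible h]; exact ih hq hR
  | full R j js h hR' ih => rw [chooseRequests_of_full h hR']; exact ih hq hR
  | choose R j js h hR' ih =>
    rw [chooseRequests_of_not_full h hR']
    refine ih (Or.inr hq) ?_
    obtain ⟨-, hsub, -⟩ := hST R q hq
    obtain ⟨T, -, hT, hcost⟩ := (ST q R).exists_attach (.single j.req.point) (hsub hq)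
    have hle := (hST (insert j.req.point R) q (Or.inr hq)).2.2 T (by
      rw [hT]; exact Set.insert_subset (Or.inr rfl) (hsub.trans Set.subset_union_left))
    have hd := (Job.isEligible_iff.1 h).2.2
    have := dist_triangle q a j.req.point
    rw [dist_comm q a] at this
    have := L.pow_nonneg
    simp only [RTree.root, RTree.cost] at hcost
    linarith

open Classical in
/-- Jobs that are not released by a time `t' ≥ t` have no influence on the choice. -/
lemma chooseRequests_filter {t' : ℝ} (ht : t ≤ t') (R : Set X) (js : List (Job X)) :
    chooseRequests ST a t L q R (js.filter fun j => j.req.release ≤ t') =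
      ((chooseRequests ST a t L q R js).1,
        (chooseRequests ST a t L q R js).2.filter fun j => j.req.release ≤ t') := by
  induction R, js using chooseRequests_induction (ST := ST) (a := a) (t := t) (L := L) (q := q) with
  | nil R => rfl
  | skip R j js h ih =>
    by_cases hj : j.req.release ≤ t'
    · simp [hj, chooseRequests_of_not_isEligible h, ih]
    · simp [hj, chooseRequests_of_not_isEligible h, ih]
  | full R j js h hR ih =>
    have hj : j.req.release ≤ t' := h.1.trans ht
    simp [hj, chooseRequests_of_full h hR, ih]
  | choose R j js h hR ih =>
    have hj : j.req.release ≤ t' := h.1.trans ht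
    simp [hj, chooseRequests_of_not_full h hR, ih]

end Choose

/-- The level of the service triggered by `j` when the server is at `a`. -/
noncomputable def serviceLevel [MetricSpace X] (a : X) (j : Job X) : Level :=
  j.adjLevel a + ((3 : ℤ) : Level)

/-- The result of the choice in the service triggered by `j` when the server is at `a` and `js`
are the other jobs. -/
noncomputable def serviceChoice [MetricSpace X] (ST : SteinerProcedure X) (a : X) (j : Job X)
    (js : List (Job X)) : Set X × List (Job X) :=
  chooseRequests ST a j.req.deadline (serviceLevel a j) j.req.point {j.req.point} js

open Classical in
/-- The location of the server after a service triggered by `j` at `a`. -/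
noncomputable def finalPos [MetricSpace X] (a : X) (j : Job X) : X :=
  if j.adjLevel a ≠ j.level then j.req.point else a

section Service

variable [MetricSpace X] {ST : SteinerProcedure X} {S : State X} {j : Job X} {js : List (Job X)}

lemma service_nil (h : S.jobs = []) : service ST S = S := by
  unfold service; rw [h]

lemma service_cons (h : S.jobs = j :: js) :
    service ST S = { pos := finalPos S.pos j
                     jobs := (serviceChoice ST S.pos j js).2
                     moves := S.moves ++ ((ST j.req.point (serviceChoice ST S.pos j js).1).tour ++
                       [S.pos, finalPos S.pos j]).map (fun x => (j.req.deadline, x)) } := by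
  unfold service; rw [h]; rfl

lemma pow_serviceLevel (a : X) (j : Job X) :
    (serviceLevel a j).pow = 8 * (j.adjLevel a).pow := by
  rw [serviceLevel, Level.pow_add_coe]; norm_num; ring

lemma dist_trigger_le (a : X) (j : Job X) :
    dist a j.req.point ≤ (serviceLevel a j).pow / 8 := by
  rw [pow_serviceLevel]; linarith [j.dist_le_pow_adjLevel a]

/-- The trigger is itself eligible. -/
lemma isEligible_trigger (a : X) (j : Job X) :
    j.IsEligible a j.req.deadline (serviceLevel a j) :=
  ⟨j.req.release_le_deadline, Level.le_add_coe _ (by norm_num)⟩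

lemma trigger_mem_serviceChoice (a : X) (j : Job X) (js : List (Job X)) :
    j.req.point ∈ (serviceChoice ST a j js).1 :=
  subset_chooseRequests_fst _ _ rfl

lemma cost_serviceChoice_le (hST : ST.IsTwoApprox) (a : X) (j : Job X) (js : List (Job X)) :
    (ST j.req.point (serviceChoice ST a j js).1).cost ≤ 11 * (serviceLevel a j).pow := by
  refine cost_chooseRequests_le hST (dist_trigger_le a j) (Set.mem_singleton _) ?_ js
  have h := (hST {j.req.point} j.req.point rfl).2.2 (.single j.req.point) subset_rfl
  have := (serviceLevel a j).pow_nonneg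
  simp only [RTree.cost] at h
  linarith

lemma dist_finalPos_le (a : X) (j : Job X) :
    dist a (finalPos a j) ≤ (serviceLevel a j).pow / 8 := by
  have := (serviceLevel a j).pow_nonneg
  unfold finalPos
  split_ifs
  · exact dist_trigger_le a j
  · rw [dist_self]; linarith

/-- The moves of a service have a cost proportional to `2 ^ L`. -/
lemma walkLength_service_le (hST : ST.IsTwoApprox) (a : X) (j : Job X) (js : List (Job X)) :
    walkLength a ((ST j.req.point (serviceChoice ST a j js).1).tour ++ [a, finalPos a j]) ≤
      23 * (serviceLevel a j).pow := by
  have hroot := (hST _ _ (trigger_mem_serviceChoice (ST := ST) a j js)).1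
  have := cost_serviceChoice_le hST a j js
  have := dist_trigger_le a j
  have := dist_finalPos_le a j
  have := (serviceLevel a j).pow_nonneg
  simp only [walkLength_append, RTree.walkLength_tour, RTree.getLastD_tour, walkLength, hroot,
    dist_comm j.req.point a]
  linarith

lemma length_jobs_service (h : S.jobs ≠ []) :
    (service ST S).jobs.length < S.jobs.length := by
  obtain ⟨j, js, hjs⟩ := List.exists_cons_of_ne_nil h
  rw [service_cons hjs, hjs]
  have := (map_req_chooseRequests_sublist (ST := ST) (a := S.pos) (t := j.req.deadline)
    (L := serviceLevel S.pos j) (q := j.req.point) {j.req.point} js).length_le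
  simp only [List.length_map] at this
  exact Nat.lt_succ_of_le this

lemma map_req_service_sublist (S : State X) :
    ((service ST S).jobs.map Job.req).Sublist (S.jobs.map Job.req) := by
  rcases hS : S.jobs with _ | ⟨j, js⟩
  · rw [service_nil hS, hS]
  · rw [service_cons hS]
    exact (map_req_chooseRequests_sublist _ js).cons _

lemma SortedJobs.service (h : SortedJobs S.jobs) : SortedJobs (service ST S).jobs :=
  List.Pairwise.sublist (map_req_service_sublist S) h

lemma length_jobs_iterate_service (S : State X) (n : ℕ) :
    ((OnlineService.service ST)^[n] S).jobs.length ≤ S.jobs.length - n := by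
  induction n generalizing S with
  | zero => simp
  | succ n ih =>
    rw [Function.iterate_succ_apply]
    refine (ih _).trans ?_
    by_cases h : S.jobs = []
    · simp [service_nil h, h]
    · have := length_jobs_service (ST := ST) h; omega

lemma jobs_iterate_service_eq_nil {n : ℕ} (hn : S.jobs.length ≤ n) :
    ((OnlineService.service ST)^[n] S).jobs = [] := by
  have := length_jobs_iterate_service (ST := ST) S n
  exact List.eq_nil_of_length_eq_zero (by omega)

lemma iterate_service_of_jobs_eq_nil (h : S.jobs = []) (n : ℕ) :
    (OnlineService.service ST)^[n] S = S :=
  Function.iterate_fixed (service_nil h) n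

end Service

/-! ### Feasibility -/

section Feasible

namespace Schedule

lemma IsAt.append {s : X} {σ τ : Schedule X} {t : ℝ} {x : X} (h : IsAt s σ t x)
    (hτ : ∀ m ∈ τ, t ≤ m.1) : IsAt s (σ ++ τ) t x := by
  obtain ⟨σ₁, σ₂, rfl, h1, h2, h3⟩ := h
  refine ⟨σ₁, σ₂ ++ τ, List.append_assoc _ _ _, h1, fun m hm => ?_, h3⟩
  exact (List.mem_append.1 hm).elim (h2 m) (hτ m)

/-- A server that visits the points of `l` at time `t` is at each of them at time `t`. -/
lemma isAt_append_map {s : X} {σ : Schedule X} {t : ℝ} {x : X} {l : List X}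
    (hσ : ∀ m ∈ σ, m.1 ≤ t) (hx : x ∈ l) : IsAt s (σ ++ l.map fun y => (t, y)) t x := by
  obtain ⟨l₁, l₂, rfl⟩ := List.append_of_mem hx
  refine ⟨σ ++ (l₁ ++ [x]).map fun y => (t, y), l₂.map fun y => (t, y), by simp, ?_, ?_, ?_⟩
  · intro m hm
    rcases List.mem_append.1 hm with hm | hm
    · exact hσ m hm
    · obtain ⟨y, -, rfl⟩ := List.mem_map.1 hm
      exact le_rfl
  · intro m hm
    obtain ⟨y, -, rfl⟩ := List.mem_map.1 hm
    exact le_rfl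
  · simp [List.getLastD_eq_getLast?]

end Schedule

/-- The state of the algorithm before the first service. -/
noncomputable def initialState (s : X) (I : Instance X) : State X :=
  open Classical in
  { pos := s
    jobs := (I.insertionSort (fun q q' => q.deadline ≤ q'.deadline)).map (fun q => ⟨q, ⊥⟩)
    moves := [] }

lemma map_req_initialState (s : X) (I : Instance X) :
    open Classical in
    (initialState s I).jobs.map Job.req =
      I.insertionSort (fun q q' => q.deadline ≤ q'.deadline) := by
  simp [initialState, Function.comp_def]

lemma sortedJobs_initialState (s : X) (I : Instance X) : SortedJobs (initialState s I).jobs := by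
  classical
  rw [SortedJobs, map_req_initialState]
  have : Std.Total fun q q' : Request X => q.deadline ≤ q'.deadline := ⟨fun _ _ => le_total _ _⟩
  have : IsTrans (Request X) fun q q' => q.deadline ≤ q'.deadline := ⟨fun _ _ _ => le_trans⟩
  exact List.pairwise_insertionSort _ _

lemma length_jobs_initialState (s : X) (I : Instance X) :
    (initialState s I).jobs.length = I.length := by
  simp [initialState]

lemma mem_map_req_initialState {s : X} {I : Instance X} {q : Request X} :
    q ∈ (initialState s I).jobs.map Job.req ↔ q ∈ I := by
  rw [map_req_initialState, List.mem_insertionSort]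

variable [MetricSpace X] {ST : SteinerProcedure X}

/-- What holds for the state after any number of services: the moves are chronological and not
later than the deadlines that remain, they lead to the current location, and every request of `I`
either remains or is served, at a moment that is not later than the deadlines that remain. -/
structure State.IsValid (s : X) (I : Instance X) (S : State X) : Prop where
  sorted : SortedJobs S.jobs
  chronological : S.moves.Pairwise fun m m' => m.1 ≤ m'.1
  le_deadline : ∀ m ∈ S.moves, ∀ j ∈ S.jobs, m.1 ≤ j.req.deadline
  last : (S.moves.map Prod.snd).getLastD s = S.pos
  served : ∀ q ∈ I, q ∈ S.jobs.map Job.req ∨ ∃ t, q.release ≤ t ∧ t ≤ q.deadline ∧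
    Schedule.IsAt s S.moves t q.point ∧ ∀ j ∈ S.jobs, t ≤ j.req.deadline

omit [MetricSpace X] in
lemma isValid_initialState (s : X) (I : Instance X) : (initialState s I).IsValid s I where
  sorted := sortedJobs_initialState s I
  chronological := List.Pairwise.nil
  le_deadline := by simp [initialState]
  last := rfl
  served q hq := Or.inl (mem_map_req_initialState.2 hq)

lemma State.IsValid.service (hST : ST.IsTwoApprox) {s : X} {I : Instance X} {S : State X}
    (h : S.IsValid s I) : (service ST S).IsValid s I := by
  rcases hS : S.jobs with _ | ⟨j, js⟩
  · rwa [service_nil hS]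
  have hsorted := h.sorted
  rw [hS] at hsorted
  have hold : ∀ m ∈ S.moves, m.1 ≤ j.req.deadline := fun m hm =>
    h.le_deadline m hm j (hS ▸ List.mem_cons_self)
  have hrest : ∀ i ∈ (serviceChoice ST S.pos j js).2, j.req.deadline ≤ i.req.deadline := by
    intro i hi
    obtain ⟨i', hi', hreq, -⟩ := exists_of_mem_chooseRequests_snd hsorted.tail hi
    rw [hreq]
    exact hsorted.le hi'
  refine ⟨h.sorted.service, ?_, ?_, ?_, ?_⟩ <;> rw [service_cons hS]
  · refine List.pairwise_append.2 ⟨h.chronological, ?_, ?_⟩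
    · exact List.pairwise_map.2 (List.pairwise_of_forall fun _ _ => le_rfl)
    · intro m hm m' hm'
      obtain ⟨y, -, rfl⟩ := List.mem_map.1 hm'
      exact hold m hm
  · intro m hm i hi
    rcases List.mem_append.1 hm with hm | hm
    · exact (hold m hm).trans (hrest i hi)
    · obtain ⟨y, -, rfl⟩ := List.mem_map.1 hm
      exact hrest i hi
  · simp [List.getLastD_eq_getLast?]
  · -- The requests that the service serves are on vertices of the tree.
    have hnew : ∀ q : Request X, q.release ≤ j.req.deadline → j.req.deadline ≤ q.deadline →
        q.point ∈ (serviceChoice ST S.pos j js).1 →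
        ∃ t, q.release ≤ t ∧ t ≤ q.deadline ∧ Schedule.IsAt s (S.moves ++
          ((ST j.req.point (serviceChoice ST S.pos j js).1).tour ++
            [S.pos, finalPos S.pos j]).map (fun x => (j.req.deadline, x))) t q.point ∧
          ∀ i ∈ (serviceChoice ST S.pos j js).2, t ≤ i.req.deadline := by
      intro q h1 h2 h3
      refine ⟨j.req.deadline, h1, h2, Schedule.isAt_append_map hold ?_, hrest⟩
      exact List.mem_append_left _
        (RTree.mem_tour ((hST _ _ (trigger_mem_serviceChoice S.pos j js)).2.1 h3))
    intro q hq
    rcases h.served q hq with hq | ⟨t, h1, h2, h3, h4⟩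
    · rw [hS, List.map_cons, List.mem_cons] at hq
      rcases hq with rfl | hq
      · exact Or.inr (hnew _ j.req.release_le_deadline le_rfl (trigger_mem_serviceChoice _ _ _))
      · obtain ⟨i, hi, rfl⟩ := List.mem_map.1 hq
        refine (mem_map_req_or_chosen _ hi).imp_right fun ⟨h1, h2⟩ => ?_
        exact hnew _ h1.1 (hsorted.le hi) h2
    · have ht : t ≤ j.req.deadline := h4 j (hS ▸ List.mem_cons_self)
      refine Or.inr ⟨t, h1, h2, h3.append ?_, fun i hi => ht.trans (hrest i hi)⟩
      intro m hm
      obtain ⟨y, -, rfl⟩ := List.mem_map.1 hm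
      exact ht

lemma isValid_iterate_service (hST : ST.IsTwoApprox) (s : X) (I : Instance X) (n : ℕ) :
    ((service ST)^[n] (initialState s I)).IsValid s I := by
  induction n with
  | zero => exact isValid_initialState s I
  | succ n ih => rw [Function.iterate_succ_apply']; exact ih.service hST

lemma isFeasible_serviceAlgorithm (hST : ST.IsTwoApprox) (s : X) (I : Instance X) :
    Schedule.IsFeasible s I (serviceAlgorithm ST s I) := by
  have h := isValid_iterate_service hST s I I.length
  refine ⟨h.chronological, fun q hq => ?_⟩
  have hnil : ((service ST)^[I.length] (initialState s I)).jobs = [] :=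
    jobs_iterate_service_eq_nil (length_jobs_initialState s I).le
  rcases h.served q hq with hq | ⟨t, h1, h2, h3, -⟩
  · simp [hnil] at hq
  · exact ⟨t, h1, h2, h3⟩

end Feasible

/-! ### The algorithm is online -/

section Online

open Classical

lemma filter_orderedInsert (p : Request X → Prop) (q : Request X) (l : List (Request X))
    (hl : l.Pairwise fun q q' => q.deadline ≤ q'.deadline) :
    (l.orderedInsert (fun q q' => q.deadline ≤ q'.deadline) q).filter (fun x => p x) =
      if p q then (l.filter (fun x => p x)).orderedInsert (fun q q' => q.deadline ≤ q'.deadline) q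
      else l.filter (fun x => p x) := by
  induction l with
  | nil => by_cases hq : p q <;> simp [hq]
  | cons a l ih =>
    obtain ⟨ha, hl⟩ := List.pairwise_cons.1 hl
    specialize ih hl
    by_cases hqa : q.deadline ≤ a.deadline
    · rw [List.orderedInsert_cons, if_pos hqa, List.filter_cons]
      by_cases hq : p q
      · simp only [hq, decide_true, if_true]
        -- All elements that the filter may leave in front have deadlines that are not earlier.
        rcases hf : (a :: l).filter (fun x => p x) with _ | ⟨b, l'⟩
        · rfl
        · have hb : b ∈ a :: l := List.mem_of_mem_filter (hf ▸ List.mem_cons_self)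
          rw [List.orderedInsert_cons, if_pos]
          rcases List.mem_cons.1 hb with rfl | hb
          · exact hqa
          · exact hqa.trans (ha b hb)
      · simp [hq]
    · rw [List.orderedInsert_cons, if_neg hqa, List.filter_cons, ih]
      by_cases hp : p a <;> by_cases hq : p q <;>
        simp [hp, hq, hqa]

lemma filter_insertionSort (p : Request X → Prop) (l : List (Request X)) :
    (l.insertionSort (fun q q' => q.deadline ≤ q'.deadline)).filter (fun x => p x) =
      (l.filter (fun x => p x)).insertionSort (fun q q' => q.deadline ≤ q'.deadline) := by
  have : Std.Total fun q q' : Request X => q.deadline ≤ q'.deadline := ⟨fun _ _ => le_total _ _⟩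
  have : IsTrans (Request X) fun q q' => q.deadline ≤ q'.deadline := ⟨fun _ _ _ => le_trans⟩
  induction l with
  | nil => rfl
  | cons q l ih =>
    rw [List.insertionSort_cons, filter_orderedInsert _ _ _ (List.pairwise_insertionSort _ _), ih,
      List.filter_cons]
    by_cases hq : p q <;> simp [hq]

lemma initialState_filter (s : X) (I : Instance X) (t : ℝ) :
    initialState s (I.filter fun q => q.release ≤ t) =
      { initialState s I with
        jobs := (initialState s I).jobs.filter fun j => j.req.release ≤ t } := by
  simp only [initialState, State.mk.injEq, true_and, and_true]
  rw [← filter_insertionSort fun q => q.release ≤ t, List.filter_map]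
  rfl

variable [MetricSpace X] {ST : SteinerProcedure X}

/-- Services that are triggered after time `t` make no moves up to time `t`. -/
lemma filter_moves_of_lt {t : ℝ} (n : ℕ) (S : State X) (h : ∀ j ∈ S.jobs, t < j.req.deadline) :
    ((service ST)^[n] S).moves.filter (fun m => m.1 ≤ t) =
      S.moves.filter (fun m => m.1 ≤ t) := by
  induction n generalizing S with
  | zero => rfl
  | succ n ih =>
    rw [Function.iterate_succ_apply, ih]
    · rcases hS : S.jobs with _ | ⟨j, js⟩
      · rw [service_nil hS]
      · rw [service_cons hS, List.filter_append, List.append_right_eq_self]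
        have hj := h j (hS ▸ List.mem_cons_self)
        rw [List.filter_eq_nil_iff]
        intro m hm
        obtain ⟨y, -, rfl⟩ := List.mem_map.1 hm
        simpa using hj
    · intro j hj
      obtain ⟨i, hi, hij⟩ := List.mem_map.1
        ((map_req_service_sublist S).subset (List.mem_map_of_mem hj))
      exact hij ▸ h i hi

lemma service_filter_jobs {t : ℝ} {S : State X} {j : Job X} {js : List (Job X)}
    (hS : S.jobs = j :: js) (hj : j.req.deadline ≤ t) :
    service ST { S with jobs := S.jobs.filter fun j => j.req.release ≤ t } =
      { service ST S with jobs := (service ST S).jobs.filter fun j => j.req.release ≤ t } := by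
  have hrel : j.req.release ≤ t := j.req.release_le_deadline.trans hj
  rw [service_cons hS, service_cons (j := j) (js := js.filter fun j => j.req.release ≤ t)
    (by simp [hS, hrel])]
  simp only [serviceChoice, chooseRequests_filter hj]

/-- Up to time `t` the algorithm does the same if the jobs released later are removed. -/
lemma filter_moves_filter_jobs {t : ℝ} (n : ℕ) (S : State X) (hS : SortedJobs S.jobs) :
    ((service ST)^[n] { S with jobs := S.jobs.filter fun j => j.req.release ≤ t }).moves.filter
        (fun m => m.1 ≤ t) = ((service ST)^[n] S).moves.filter (fun m => m.1 ≤ t) := by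
  induction n generalizing S with
  | zero => rfl
  | succ n ih =>
    rcases hjobs : S.jobs with _ | ⟨j, js⟩
    · rw [iterate_service_of_jobs_eq_nil hjobs, iterate_service_of_jobs_eq_nil (by simp)]
    · by_cases hj : j.req.deadline ≤ t
      · rw [Function.iterate_succ_apply, Function.iterate_succ_apply, ← ih _ hS.service,
          ← service_filter_jobs hjobs hj, hjobs]
      · rw [hjobs] at hS
        have hlt : ∀ i ∈ j :: js, t < i.req.deadline := by
          intro i hi
          rcases List.mem_cons.1 hi with rfl | hi
          · exact not_le.1 hj
          · exact (not_le.1 hj).trans_le (hS.le hi)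
        rw [filter_moves_of_lt, filter_moves_of_lt _ _ (hjobs ▸ hlt)]
        exact fun i hi => hlt i (List.mem_filter.1 hi).1

lemma serviceAlgorithm_eq {s : X} {I : Instance X} {n : ℕ} (hn : I.length ≤ n) :
    serviceAlgorithm ST s I = ((service ST)^[n] (initialState s I)).moves := by
  obtain ⟨k, rfl⟩ := Nat.exists_eq_add_of_le' hn
  rw [Function.iterate_add_apply, iterate_service_of_jobs_eq_nil]
  · rfl
  · exact jobs_iterate_service_eq_nil (length_jobs_initialState s I).le

lemma filter_serviceAlgorithm (s : X) (I : Instance X) (t : ℝ) :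
    (serviceAlgorithm ST s I).filter (fun m => m.1 ≤ t) =
      (serviceAlgorithm ST s (I.filter fun q => q.release ≤ t)).filter (fun m => m.1 ≤ t) := by
  rw [serviceAlgorithm_eq le_rfl, serviceAlgorithm_eq (List.length_filter_le _ I),
    initialState_filter, filter_moves_filter_jobs _ _ (sortedJobs_initialState s I)]

lemma isOnline_serviceAlgorithm (ST : SteinerProcedure X) : (serviceAlgorithm ST).IsOnline := by
  intro s I I' t h
  rw [filter_serviceAlgorithm, h, ← filter_serviceAlgorithm]

end Online

/-! ### Offline schedules as walks -/

namespace Schedule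

/-- The location of the server after its first `i` moves. -/
def posAfter (s : X) (σ : Schedule X) (i : ℕ) : X :=
  ((σ.take i).map Prod.snd).getLastD s

open Classical in
/-- The number of moves that are made up to time `t`. -/
noncomputable def numMoves (σ : Schedule X) (t : ℝ) : ℕ :=
  σ.countP fun m => m.1 ≤ t

@[simp] lemma posAfter_zero (s : X) (σ : Schedule X) : posAfter s σ 0 = s := by
  simp [posAfter]

lemma posAfter_cons_succ (s : X) (m : ℝ × X) (σ : Schedule X) (i : ℕ) :
    posAfter s (m :: σ) (i + 1) = posAfter m.2 σ i := by
  simp only [posAfter, List.take_succ_cons, List.map_cons, List.getLastD_cons]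

lemma numMoves_mono (σ : Schedule X) {t t' : ℝ} (h : t ≤ t') : numMoves σ t ≤ numMoves σ t' :=
  List.countP_mono_left fun m _ hm => by
    simp only [decide_eq_true_eq] at hm ⊢
    exact hm.trans h

lemma numMoves_le_length (σ : Schedule X) (t : ℝ) : numMoves σ t ≤ σ.length :=
  List.countP_le_length

/-- A request that is served is visited after some number of moves, which is at most the number of
moves up to the deadline and at least the number of moves before the release. -/
lemma Serves.exists_posAfter {s : X} {σ : Schedule X} {q : Request X} (h : Serves s σ q) :
    ∃ i ≤ numMoves σ q.deadline, posAfter s σ i = q.point ∧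
      ∀ t < q.release, numMoves σ t ≤ i := by
  classical
  obtain ⟨t₀, h1, h2, σ₁, σ₂, rfl, h3, h4, h5⟩ := h
  refine ⟨σ₁.length, ?_, ?_, fun t ht => ?_⟩
  · have : σ₁.countP (fun m => m.1 ≤ q.deadline) = σ₁.length :=
      List.countP_eq_length.2 fun m hm => by simpa using (h3 m hm).trans h2
    rw [numMoves, List.countP_append, this]
    exact Nat.le_add_right _ _
  · simpa [posAfter] using h5
  · have : σ₂.countP (fun m => m.1 ≤ t) = 0 :=
      List.countP_eq_zero.2 fun m hm => by simpa using (ht.trans_le h1).trans_le (h4 m hm)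
    rw [numMoves, List.countP_append, this]
    exact List.countP_le_length

lemma sum_dist_posAfter [MetricSpace X] (s : X) (σ : Schedule X) :
    ∑ i ∈ Finset.range σ.length, dist (posAfter s σ i) (posAfter s σ (i + 1)) = cost s σ := by
  induction σ generalizing s with
  | nil => rfl
  | cons m σ ih =>
    rw [List.length_cons, Finset.sum_range_succ', add_comm]
    simp only [posAfter_cons_succ, posAfter_zero]
    rw [ih]
    rfl

end Schedule

/-! ### Weights of the offline moves -/

/-- What a move of length `d` contributes to the charges at level `m` in a space with `n` points:
moves much shorter than `2 ^ m / n` count nothing, and no move counts more than `2 ^ m`. -/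
noncomputable def moveWeight (n : ℕ) (m : ℤ) (d : ℝ) : ℝ :=
  if (2 : ℝ) ^ m ≤ 128 * n * d then min d (2 ^ m) else 0

lemma moveWeight_nonneg (n : ℕ) (m : ℤ) {d : ℝ} (hd : 0 ≤ d) : 0 ≤ moveWeight n m d := by
  unfold moveWeight
  split_ifs
  · exact le_min hd (by positivity)
  · exact le_rfl

lemma sum_zpow_le (F : Finset ℤ) (e : ℤ) (hF : ∀ m ∈ F, m ≤ e) :
    ∑ m ∈ F, (2 : ℝ) ^ m ≤ 2 ^ (e + 1) := by
  induction F using Finset.induction_on_max generalizing e with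
  | empty => simp only [Finset.sum_empty]; positivity
  | insert a F ha ih =>
    rw [Finset.sum_insert fun h => lt_irrefl _ (ha a h)]
    have h1 := ih (a - 1) fun m hm => by have := ha m hm; omega
    have h2 : (2 : ℝ) ^ (a + 1) ≤ 2 ^ (e + 1) :=
      zpow_le_zpow_right₀ one_le_two (by have := hF a (Finset.mem_insert_self _ _); omega)
    rw [sub_add_cancel] at h1
    rw [zpow_add_one₀ two_ne_zero] at h2
    linarith

/-- A move of length about `2 ^ e` contributes to `O(log n)` levels above `e`, while its
contributions to the levels up to `e` form a geometric series. -/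
lemma sum_moveWeight_le (n : ℕ) (F : Finset ℤ) {d : ℝ} (hd : 0 ≤ d) :
    ∑ m ∈ F, moveWeight n m d ≤ (9 + Nat.clog 2 n) * d := by
  rcases hd.eq_or_lt with rfl | hd
  · have : ∀ m : ℤ, ¬ (2 : ℝ) ^ m ≤ 0 := fun m => not_le.2 (by positivity)
    simp [moveWeight, this]
  obtain ⟨e, he, he'⟩ := exists_mem_Ico_zpow hd (one_lt_two (α := ℝ))
  rw [← Finset.sum_filter_add_sum_filter_not F fun m => m ≤ e]
  have h1 : ∑ m ∈ F with m ≤ e, moveWeight n m d ≤ 2 * d := by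
    calc ∑ m ∈ F with m ≤ e, moveWeight n m d ≤ ∑ m ∈ F with m ≤ e, (2 : ℝ) ^ m := by
          refine Finset.sum_le_sum fun m _ => ?_
          unfold moveWeight
          split_ifs
          · exact min_le_right _ _
          · positivity
      _ ≤ 2 ^ (e + 1) := sum_zpow_le _ _ fun m hm => (Finset.mem_filter.1 hm).2
      _ ≤ 2 * d := by rw [zpow_add_one₀ two_ne_zero]; linarith
  have h2 : ∑ m ∈ F with ¬ m ≤ e, moveWeight n m d ≤ (7 + Nat.clog 2 n) * d := by
    have hn : (n : ℝ) ≤ 2 ^ (Nat.clog 2 n : ℤ) := by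
      exact_mod_cast Nat.le_pow_clog one_lt_two n
    calc ∑ m ∈ F with ¬ m ≤ e, moveWeight n m d
        ≤ ∑ m ∈ F with ¬ m ≤ e, if m ∈ Finset.Ioc e (e + 7 + Nat.clog 2 n) then d else 0 := by
          refine Finset.sum_le_sum fun m hm => ?_
          unfold moveWeight
          split_ifs with h h' h'
          · exact min_le_left _ _
          · exfalso
            apply h'
            have hlt : (2 : ℝ) ^ m < 2 ^ (e + 8 + Nat.clog 2 n) := by
              calc (2 : ℝ) ^ m ≤ 128 * n * d := h
                _ ≤ 128 * 2 ^ (Nat.clog 2 n : ℤ) * d := by gcongr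
                _ < 128 * 2 ^ (Nat.clog 2 n : ℤ) * 2 ^ (e + 1) := by gcongr
                _ = 2 ^ (e + 8 + Nat.clog 2 n) := by
                  rw [zpow_add₀ two_ne_zero, zpow_add₀ two_ne_zero, zpow_add₀ two_ne_zero]
                  norm_num; ring
            have := (zpow_lt_zpow_iff_right₀ (one_lt_two (α := ℝ))).1 hlt
            have := (Finset.mem_filter.1 hm).2
            rw [Finset.mem_Ioc]
            omega
          · exact hd.le
          · exact le_rfl
      _ = ∑ m ∈ {m ∈ F | ¬ m ≤ e} with m ∈ Finset.Ioc e (e + 7 + Nat.clog 2 n), d :=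
          (Finset.sum_filter _ _).symm
      _ ≤ ∑ m ∈ Finset.Ioc e (e + 7 + Nat.clog 2 n), d :=
          Finset.sum_le_sum_of_subset_of_nonneg (fun m hm => (Finset.mem_filter.1 hm).2)
            fun _ _ _ => hd.le
      _ = (7 + Nat.clog 2 n) * d := by
          rw [Finset.sum_const, Int.card_Ioc, nsmul_eq_mul]
          congr 1
          have : (e + 7 + Nat.clog 2 n - e).toNat = 7 + Nat.clog 2 n := by omega
          rw [this]; push_cast; rfl
  linarith

/-- If `2 ^ lev k` is covered by the weights of the moves in `box k`, where boxes of the same level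
are disjoint, then the sum of the `2 ^ lev k` is at most `O(log n)` times the total length. -/
lemma sum_zpow_le_of_disjoint (n : ℕ) {d : ℕ → ℝ} (hd : ∀ i, 0 ≤ d i) {M : ℕ} {B : Finset ℕ}
    {lev : ℕ → ℤ} {box : ℕ → Finset ℕ} (hbox : ∀ k ∈ B, box k ⊆ Finset.range M)
    (hdisj : ∀ k ∈ B, ∀ k' ∈ B, k < k' → lev k = lev k' → Disjoint (box k) (box k'))
    (hw : ∀ k ∈ B, (2 : ℝ) ^ lev k / 128 ≤ ∑ i ∈ box k, moveWeight n (lev k) (d i)) :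
    ∑ k ∈ B, (2 : ℝ) ^ lev k ≤ 128 * (9 + Nat.clog 2 n) * ∑ i ∈ Finset.range M, d i := by
  have key : ∑ k ∈ B, (2 : ℝ) ^ lev k / 128 ≤
      (9 + Nat.clog 2 n) * ∑ i ∈ Finset.range M, d i := by
    calc ∑ k ∈ B, (2 : ℝ) ^ lev k / 128
        ≤ ∑ k ∈ B, ∑ i ∈ Finset.range M,
            if i ∈ box k then moveWeight n (lev k) (d i) else 0 := by
          refine Finset.sum_le_sum fun k hk => (hw k hk).trans_eq ?_
          rw [Finset.sum_ite_mem, Finset.inter_eq_right.2 (hbox k hk)]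
      _ = ∑ i ∈ Finset.range M, ∑ k ∈ B with i ∈ box k, moveWeight n (lev k) (d i) := by
          rw [Finset.sum_comm]
          exact Finset.sum_congr rfl fun i _ => (Finset.sum_filter _ _).symm
      _ ≤ ∑ i ∈ Finset.range M, (9 + Nat.clog 2 n) * d i := by
          refine Finset.sum_le_sum fun i _ => ?_
          -- The boxes that contain the move `i` have distinct levels.
          have hinj : Set.InjOn lev ({k ∈ B | i ∈ box k} : Finset ℕ) := by
            intro k hk k' hk' heq
            simp only [Finset.coe_filter, Set.mem_ofPred_eq] at hk hk'
            by_contra hne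
            rcases lt_or_gt_of_ne hne with hlt | hlt
            · exact Finset.disjoint_left.1 (hdisj k hk.1 k' hk'.1 hlt heq) hk.2 hk'.2
            · exact Finset.disjoint_left.1 (hdisj k' hk'.1 k hk.1 hlt heq.symm) hk'.2 hk.2
          rw [← Finset.sum_image (f := fun m => moveWeight n m (d i)) hinj]
          exact sum_moveWeight_le n _ (hd i)
      _ = _ := by rw [Finset.mul_sum]
  rw [← Finset.sum_div] at key
  linarith

section Ball

variable [Fintype X] [MetricSpace X]

/-- If every tree on the points of a walk is expensive, then the weights of its moves are large:
the moves that do not count are too short to form half of the tree of first arrivals. -/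
lemma le_sum_moveWeight (p : ℕ → X) {u e : ℕ} (hue : u ≤ e) {m : ℤ}
    (hT : ∀ T : RTree X, (∀ i, u ≤ i → i ≤ e → p i ∈ T.points) → (2 : ℝ) ^ m / 64 ≤ T.cost) :
    (2 : ℝ) ^ m / 128 ≤
      ∑ i ∈ Finset.Ico u e, moveWeight (Fintype.card X) m (dist (p i) (p (i + 1))) := by
  have hV : (0 : ℝ) < 2 ^ m := by positivity
  have hn : (1 : ℝ) ≤ Fintype.card X := by
    exact_mod_cast Fintype.card_pos_iff.2 ⟨p 0⟩
  by_cases hlong : ∃ i ∈ Finset.Ico u e, (2 : ℝ) ^ m < dist (p i) (p (i + 1))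
  · obtain ⟨i, hi, hlt⟩ := hlong
    refine le_trans ?_ (Finset.single_le_sum
      (f := fun i => moveWeight (Fintype.card X) m (dist (p i) (p (i + 1))))
      (fun i _ => moveWeight_nonneg _ _ dist_nonneg) hi)
    simp only [moveWeight]
    rw [if_pos, min_eq_right hlt.le]
    · linarith
    · nlinarith
  · push Not at hlong
    obtain ⟨T, h1, h2⟩ := RTree.exists_tree_of_walk p
      (ε := 2 ^ m / (128 * Fintype.card X)) (by positivity) u e hue
    have h3 := hT T h1
    have h4 : (2 : ℝ) ^ m / (128 * Fintype.card X) * Fintype.card X = 2 ^ m / 128 := by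
      field_simp
    have h5 : ∑ i ∈ Finset.Ico u e, (if (2 : ℝ) ^ m / (128 * Fintype.card X) ≤
          dist (p i) (p (i + 1)) then dist (p i) (p (i + 1)) else 0) =
        ∑ i ∈ Finset.Ico u e, moveWeight (Fintype.card X) m (dist (p i) (p (i + 1))) := by
      refine Finset.sum_congr rfl fun i hi => ?_
      rw [moveWeight, min_eq_left (hlong i hi)]
      congr 1
      rw [div_le_iff₀ (by positivity), mul_comm]
    rw [h4, h5] at h2
    linarith

/-- The same for the moves that start in a ball, if the walk starts well inside it: a walk that
leaves the ball is cut off there, and the distance covered so far is large enough. -/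
lemma le_sum_moveWeight_ball (p : ℕ → X) {u e : ℕ} (hue : u ≤ e) {m : ℤ} {c : X}
    (hc : dist (p u) c ≤ 2 ^ m / 8)
    (hT : ∀ T : RTree X, (∀ i, u ≤ i → i ≤ e → p i ∈ T.points) → (2 : ℝ) ^ m / 64 ≤ T.cost) :
    (2 : ℝ) ^ m / 128 ≤ ∑ i ∈ Finset.Ico u e with dist (p i) c ≤ 2 ^ m / 4,
      moveWeight (Fintype.card X) m (dist (p i) (p (i + 1))) := by
  classical
  have hV : (0 : ℝ) < 2 ^ m := by positivity
  by_cases hex : ∃ i, u ≤ i ∧ i < e ∧ 2 ^ m / 4 < dist (p i) c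
  · obtain ⟨h1, h2, h3⟩ := Nat.find_spec hex
    set f := Nat.find hex
    refine (le_sum_moveWeight p h1 (m := m) fun T hT' => ?_).trans
      (Finset.sum_le_sum_of_subset_of_nonneg (fun i hi => ?_)
        fun i _ _ => moveWeight_nonneg _ _ dist_nonneg)
    · have := T.dist_le_cost (hT' f h1 le_rfl) (hT' u le_rfl h1)
      have := dist_triangle (p f) (p u) c
      linarith
    · rw [Finset.mem_Ico] at hi
      rw [Finset.mem_filter, Finset.mem_Ico]
      refine ⟨⟨hi.1, hi.2.trans h2⟩, ?_⟩
      by_contra hlt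
      exact Nat.find_min hex hi.2 ⟨hi.1, hi.2.trans h2, not_le.1 hlt⟩
  · push Not at hex
    rw [Finset.filter_true_of_mem fun i hi =>
      hex i (Finset.mem_Ico.1 hi).1 (Finset.mem_Ico.1 hi).2]
    exact le_sum_moveWeight p hue hT

end Ball

/-! ### Runs of the algorithm -/

/-- A run of the algorithm: the states before and after each of its services, and the triggering
job and the other jobs of each service.  Values at larger indices are irrelevant. -/
structure Run [MetricSpace X] (ST : SteinerProcedure X) (s : X) (I : Instance X) where
  length : ℕ
  state : ℕ → State X
  trigger : ℕ → Job X
  rest : ℕ → List (Job X)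
  state_zero : state 0 = initialState s I
  jobs_eq : ∀ k < length, (state k).jobs = trigger k :: rest k
  state_succ : ∀ k < length, state (k + 1) = service ST (state k)

section Runs

variable [MetricSpace X] {ST : SteinerProcedure X} {s : X} {I : Instance X}

lemma exists_run (ST : SteinerProcedure X) (s : X) (I : Instance X) :
    ∃ r : Run ST s I, (r.state r.length).moves = serviceAlgorithm ST s I := by
  classical
  have hex : ∃ n, ((service ST)^[n] (initialState s I)).jobs = [] :=
    ⟨I.length, jobs_iterate_service_eq_nil (length_jobs_initialState s I).le⟩
  refine ⟨⟨Nat.find hex, fun k => (service ST)^[k] (initialState s I),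
    fun k => ((service ST)^[k] (initialState s I)).jobs.headD ⟨⟨s, 0, 0, le_rfl⟩, ⊥⟩,
    fun k => ((service ST)^[k] (initialState s I)).jobs.tail, rfl, fun k hk => ?_,
    fun k _ => Function.iterate_succ_apply' _ _ _⟩, ?_⟩
  · obtain ⟨j, js, h⟩ := List.exists_cons_of_ne_nil (Nat.find_min hex hk)
    simp [h]
  · have hle : Nat.find hex ≤ I.length :=
      Nat.find_min' hex (jobs_iterate_service_eq_nil (length_jobs_initialState s I).le)
    obtain ⟨k, hk⟩ := Nat.exists_eq_add_of_le' hle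
    rw [serviceAlgorithm_eq le_rfl]
    conv_rhs => rw [hk, Function.iterate_add_apply,
      iterate_service_of_jobs_eq_nil (Nat.find_spec hex)]

namespace Run

variable (r : Run ST s I)

/-- The location of the server before service `k`. -/
def pos (k : ℕ) : X := (r.state k).pos

/-- The point of the request that triggers service `k`. -/
def point (k : ℕ) : X := (r.trigger k).req.point

/-- The time of service `k`. -/
def time (k : ℕ) : ℝ := (r.trigger k).req.deadline

/-- The level of service `k`. -/
noncomputable def level (k : ℕ) : Level := serviceLevel (r.pos k) (r.trigger k)

/-- The points of the requests that are chosen in service `k`. -/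
noncomputable def chosen (k : ℕ) : Set X := (serviceChoice ST (r.pos k) (r.trigger k) (r.rest k)).1

/-- Service `k` is primary. -/
def IsPrimary (k : ℕ) : Prop := (r.trigger k).adjLevel (r.pos k) ≠ (r.trigger k).level

variable {r}

lemma trigger_mem {k : ℕ} (hk : k < r.length) : r.trigger k ∈ (r.state k).jobs :=
  r.jobs_eq k hk ▸ List.mem_cons_self

lemma isValid (hST : ST.IsTwoApprox) {k : ℕ} (hk : k ≤ r.length) : (r.state k).IsValid s I := by
  induction k with
  | zero => rw [r.state_zero]; exact isValid_initialState s I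
  | succ k ih => rw [r.state_succ k hk]; exact (ih (Nat.le_of_succ_le hk)).service hST

lemma sublist {k k' : ℕ} (h : k ≤ k') (hk' : k' ≤ r.length) :
    ((r.state k').jobs.map Job.req).Sublist ((r.state k).jobs.map Job.req) := by
  induction k', h using Nat.le_induction with
  | base => exact List.Sublist.refl _
  | succ k' h ih =>
    rw [r.state_succ k' hk']
    exact (map_req_service_sublist _).trans (ih (Nat.le_of_succ_le hk'))

lemma sorted {k : ℕ} (hk : k ≤ r.length) : SortedJobs (r.state k).jobs := by
  have h := r.sublist (Nat.zero_le k) hk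
  rw [r.state_zero] at h
  exact List.Pairwise.sublist h (sortedJobs_initialState s I)

lemma req_mem {k : ℕ} (hk : k ≤ r.length) {j : Job X} (hj : j ∈ (r.state k).jobs) :
    j.req ∈ I := by
  have h := (r.sublist (Nat.zero_le k) hk).subset (List.mem_map_of_mem hj)
  rw [r.state_zero] at h
  exact mem_map_req_initialState.1 h

/-- The trigger has the earliest deadline. -/
lemma time_le_deadline {k : ℕ} (hk : k < r.length) {j : Job X} (hj : j ∈ (r.state k).jobs) :
    r.time k ≤ j.req.deadline := by
  have hs := r.sorted hk.le
  rw [r.jobs_eq k hk] at hs hj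
  rcases List.mem_cons.1 hj with rfl | hj
  · exact le_rfl
  · exact hs.le hj

lemma time_mono {k k' : ℕ} (h : k ≤ k') (hk' : k' < r.length) : r.time k ≤ r.time k' := by
  obtain ⟨j, hj, hreq⟩ := List.mem_map.1
    ((r.sublist h hk'.le).subset (List.mem_map_of_mem (trigger_mem hk')))
  rw [show r.time k' = j.req.deadline by rw [hreq]; rfl]
  exact time_le_deadline (h.trans_lt hk') hj

lemma pos_succ {k : ℕ} (hk : k < r.length) :
    r.pos (k + 1) = finalPos (r.pos k) (r.trigger k) := by
  rw [pos, r.state_succ k hk, service_cons (r.jobs_eq k hk)]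
  rfl

/-- A job that remains after service `k` was not eligible and is unchanged, or was eligible and left
over, in which case the tree is expensive and the requests chosen have deadlines no later. -/
lemma exists_parent {k : ℕ} (hk : k < r.length) {j' : Job X} (hj' : j' ∈ (r.state (k + 1)).jobs) :
    ∃ j ∈ (r.state k).jobs, j'.req = j.req ∧
      ((¬ j.IsEligible (r.pos k) (r.time k) (r.level k) ∧ j' = j) ∨
      (j.IsEligible (r.pos k) (r.time k) (r.level k) ∧
        j'.level = r.level k + ((1 : ℤ) : Level) ∧
        4 * (r.level k).pow ≤ (ST (r.point k) (r.chosen k)).cost ∧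
        ∀ x ∈ r.chosen k, ∃ i ∈ (r.state k).jobs,
          i.IsEligible (r.pos k) (r.time k) (r.level k) ∧ i.req.point = x ∧
            i.req.deadline ≤ j.req.deadline)) := by
  have hs := r.sorted hk.le
  rw [r.jobs_eq k hk] at hs
  rw [r.state_succ k hk, service_cons (r.jobs_eq k hk)] at hj'
  obtain ⟨j, hj, hreq, h⟩ := exists_of_mem_chooseRequests_snd hs.tail hj'
  rw [r.jobs_eq k hk]
  refine ⟨j, List.mem_cons_of_mem _ hj, hreq, h.imp_right ?_⟩
  rintro ⟨h1, h2, h3, h4⟩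
  refine ⟨h1, h2, h3, fun x hx => ?_⟩
  rcases h4 x hx with rfl | ⟨i, hi, h'⟩
  · exact ⟨r.trigger k, List.mem_cons_self, isEligible_trigger _ _, rfl, hs.le hj⟩
  · exact ⟨i, List.mem_cons_of_mem _ hi, h'⟩

/-- Levels of jobs never decrease. -/
lemma exists_ancestor {k k' : ℕ} (h : k ≤ k') (hk' : k' ≤ r.length) {j' : Job X}
    (hj' : j' ∈ (r.state k').jobs) :
    ∃ j ∈ (r.state k).jobs, j.req = j'.req ∧ j.level ≤ j'.level := by
  induction k', h using Nat.le_induction generalizing j' with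
  | base => exact ⟨j', hj', rfl, le_rfl⟩
  | succ k' h ih =>
    obtain ⟨i, hi, hreq, hi'⟩ := exists_parent hk' hj'
    obtain ⟨j, hj, hreq', hlev⟩ := ih (Nat.le_of_succ_le hk') hi
    refine ⟨j, hj, hreq'.trans hreq.symm, hlev.trans ?_⟩
    rcases hi' with ⟨-, rfl⟩ | ⟨h1, h2, -, -⟩
    · exact le_rfl
    · rw [h2]
      exact (Job.isEligible_iff.1 h1).2.1.trans (Level.le_add_coe _ zero_le_one)

/-- A job that is pending at service `k` and still has a level of at most that of the service
later on was not eligible because of its distance. -/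
lemma pow_level_lt_dist {k k' : ℕ} (h : k < k') (hk' : k' ≤ r.length) {j : Job X}
    (hj : j ∈ (r.state k').jobs) (hbot : r.level k ≠ ⊥) (hlev : j.level ≤ r.level k)
    (hrel : j.req.release ≤ r.time k) : (r.level k).pow < dist (r.pos k) j.req.point := by
  obtain ⟨j₁, hj₁, hreq₁, hlev₁⟩ := exists_ancestor (Nat.succ_le_of_lt h) hk' hj
  obtain ⟨j₀, hj₀, hreq₀, ⟨hne, rfl⟩ | ⟨-, h1, -, -⟩⟩ := exists_parent (h.trans_le hk') hj₁
  · by_contra hle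
    rw [← hreq₁] at hrel hle
    exact hne (Job.isEligible_iff.2 ⟨hrel, hlev₁.trans hlev, not_lt.1 hle⟩)
  · exact absurd (h1 ▸ hlev₁.trans hlev) (Level.not_add_one_le hbot)

/-- A job with a level other than `-∞` got it when it was left over by an earlier service. -/
lemma exists_origin {k : ℕ} (hk : k ≤ r.length) {j : Job X} (hj : j ∈ (r.state k).jobs)
    (hbot : j.level ≠ ⊥) :
    ∃ k₀ < k, r.level k₀ + ((1 : ℤ) : Level) = j.level ∧ j.req.release ≤ r.time k₀ ∧
      dist (r.pos k₀) j.req.point ≤ (r.level k₀).pow ∧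
      4 * (r.level k₀).pow ≤ (ST (r.point k₀) (r.chosen k₀)).cost ∧
      ∀ x ∈ r.chosen k₀, ∃ i ∈ (r.state k₀).jobs,
        i.IsEligible (r.pos k₀) (r.time k₀) (r.level k₀) ∧ i.req.point = x ∧
          i.req.deadline ≤ j.req.deadline := by
  induction k generalizing j with
  | zero =>
    rw [r.state_zero] at hj
    obtain ⟨q, -, rfl⟩ := List.mem_map.1 hj
    exact absurd rfl hbot
  | succ k ih =>
    obtain ⟨i, hi, hreq, ⟨-, rfl⟩ | ⟨h1, h2, h3, h4⟩⟩ := exists_parent hk hj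
    · obtain ⟨k₀, hk₀, h⟩ := ih (Nat.le_of_succ_le hk) hi hbot
      exact ⟨k₀, hk₀.trans k.lt_succ_self, h⟩
    · obtain ⟨h5, -, h6⟩ := Job.isEligible_iff.1 h1
      rw [hreq]
      exact ⟨k, k.lt_succ_self, h2.symm, h5, h6, h3, h4⟩

lemma dist_pos_point_le (k : ℕ) : dist (r.pos k) (r.point k) ≤ (r.level k).pow / 8 :=
  dist_trigger_le _ _

lemma level_trigger_le (k : ℕ) : (r.trigger k).level ≤ r.level k :=
  (le_max_left _ _).trans (Level.le_add_coe _ (by norm_num))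

lemma IsPrimary.level_ne_bot {k : ℕ} (h : r.IsPrimary k) : r.level k ≠ ⊥ := by
  intro hbot
  have h1 : (r.trigger k).adjLevel (r.pos k) = ⊥ :=
    le_bot_iff.1 (hbot ▸ Level.le_add_coe _ (by norm_num))
  exact h (h1.trans (le_bot_iff.1 (h1 ▸ le_max_left _ _)).symm)

/-- The adjusted level of the trigger of a primary service is that of its distance. -/
lemma IsPrimary.lt_dist {k : ℕ} (h : r.IsPrimary k) :
    (r.level k).pow / 16 < dist (r.pos k) (r.point k) := by
  have hadj : (r.trigger k).adjLevel (r.pos k) = distLevel (r.pos k) (r.point k) := by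
    rcases max_choice (r.trigger k).level (distLevel (r.pos k) (r.trigger k).req.point) with h' | h'
    · exact absurd h' h
    · exact h'
  have hbot := h.level_ne_bot
  have hpow : (r.level k).pow = 8 * ((r.trigger k).adjLevel (r.pos k)).pow := pow_serviceLevel _ _
  rw [level, serviceLevel] at hbot
  obtain ⟨m, hm⟩ := WithBot.ne_bot_iff_exists.1 (WithBot.add_ne_bot.1 hbot).1
  rw [← hm] at hpow hadj
  by_contra hle
  have hle' : distLevel (r.pos k) (r.point k) ≤ ((m - 1 : ℤ) : Level) := by
    rw [distLevel_le_iff]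
    refine (not_lt.1 hle).trans_eq ?_
    rw [hpow, Level.pow_coe, Level.pow_coe, zpow_sub_one₀ two_ne_zero]
    ring
  rw [← hadj, WithBot.coe_le_coe] at hle'
  omega

lemma pos_succ_of_isPrimary {k : ℕ} (hk : k < r.length) (h : r.IsPrimary k) :
    r.pos (k + 1) = r.point k :=
  (pos_succ hk).trans (if_pos h)

lemma pos_succ_of_not_isPrimary {k : ℕ} (hk : k < r.length) (h : ¬ r.IsPrimary k) :
    r.pos (k + 1) = r.pos k :=
  (pos_succ hk).trans (if_neg h)

lemma cost_moves_le (hST : ST.IsTwoApprox) {k : ℕ} (hk : k ≤ r.length) :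
    Schedule.cost s (r.state k).moves ≤ 23 * ∑ i ∈ Finset.range k, (r.level i).pow := by
  induction k with
  | zero => simp [r.state_zero, initialState, Schedule.cost, walkLength]
  | succ k ih =>
    have hw := walkLength_service_le hST (r.pos k) (r.trigger k) (r.rest k)
    have := ih (Nat.le_of_succ_le hk)
    rw [Schedule.cost] at this ⊢
    rw [r.state_succ k hk, service_cons (r.jobs_eq k hk), List.map_append, walkLength_append,
      (isValid hST (Nat.le_of_succ_le hk)).last, Finset.sum_range_succ, List.map_map]
    have hid : (Prod.snd ∘ fun x : X => ((r.trigger k).req.deadline, x)) = id := rfl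
    rw [hid, List.map_id]
    rw [level]
    unfold pos at hw ⊢
    linarith

end Run

end Runs

/-! ### Charging services to an offline solution -/

namespace Run

section Offline

variable [MetricSpace X] {ST : SteinerProcedure X} {s : X} {I : Instance X} (r : Run ST s I)
  (σ : Schedule X)

/-- The number of moves of the offline schedule `σ` up to the time of service `k`. -/
noncomputable def offlineMoves (k : ℕ) : ℕ := σ.numMoves (r.time k)

/-- At the time of service `k` the offline server is away from the triggering request. -/
def IsFar (k : ℕ) : Prop :=
  (r.level k).pow / 64 < dist (σ.posAfter s (r.offlineMoves σ k)) (r.point k)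

/-- Service `k` is charged directly to offline moves: it is secondary, or it is primary and finds
the offline server away from the trigger. -/
def IsCharged (k : ℕ) : Prop :=
  r.level k ≠ ⊥ ∧ (r.IsPrimary k → r.IsFar σ k)

variable {r σ}

/-- A job that is unserved before service `k'`, with a level of at most that of an earlier service
`k` nearby, was released after service `k`, since it would have been eligible there. -/
lemma time_lt_release {k k' : ℕ} (h : k < k') (hk' : k' ≤ r.length) {j : Job X}
    (hj : j ∈ (r.state k').jobs) (hbot : r.level k ≠ ⊥) (hlev : j.level ≤ r.level k)
    (hd : dist (r.point k) j.req.point ≤ 3 / 4 * (r.level k).pow) :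
    r.time k < j.req.release := by
  by_contra hle
  have h1 := pow_level_lt_dist h hk' hj hbot hlev (not_lt.1 hle)
  have h2 := r.dist_pos_point_le k
  have h3 := (r.level k).pow_nonneg
  linarith [dist_triangle (r.pos k) (r.point k) j.req.point]

/-- A primary service that finds the offline server far away: the offline server served the
trigger and has left it since. -/
lemma exists_start_of_isPrimary (hσ : Schedule.IsFeasible s I σ) {k : ℕ} (hk : k < r.length)
    (hbot : r.level k ≠ ⊥) (hfar : r.IsFar σ k) :
    ∃ u ≤ r.offlineMoves σ k, dist (σ.posAfter s u) (r.point k) ≤ (r.level k).pow / 8 ∧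
      (∀ T : RTree X, (∀ i, u ≤ i → i ≤ r.offlineMoves σ k → σ.posAfter s i ∈ T.points) →
        (r.level k).pow / 64 ≤ T.cost) ∧
      ∀ k₁ < k, r.level k₁ = r.level k → dist (r.point k₁) (r.point k) ≤ (r.level k).pow / 2 →
        r.offlineMoves σ k₁ ≤ u := by
  have hV := (r.level k).pow_nonneg
  obtain ⟨u, hu, hpu, hrel⟩ := (hσ.2 _ (req_mem hk.le (trigger_mem hk))).exists_posAfter
  refine ⟨u, hu, ?_, fun T hT => ?_, fun k₁ hk₁ hlev hd => hrel _ ?_⟩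
  · rw [show σ.posAfter s u = r.point k from hpu, dist_self]
    linarith
  · have := T.dist_le_cost (hT _ hu le_rfl) (hT u le_rfl hu)
    rw [hpu] at this
    exact hfar.le.trans this
  · refine time_lt_release hk₁ hk.le (trigger_mem hk) (hlev ▸ hbot)
      (hlev ▸ r.level_trigger_le k) ?_
    change dist (r.point k₁) (r.point k) ≤ _
    rw [hlev]
    linarith

/-- A secondary service of level `L`: the trigger was left over by a service of level `L - 4`, and
by now the offline server has served all requests that were chosen there, whose tree has a cost of
at least `4 * 2 ^ (L - 4)`. -/
lemma exists_start_of_not_isPrimary (hST : ST.IsTwoApprox) (hσ : Schedule.IsFeasible s I σ)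
    {k : ℕ} (hk : k < r.length) (hbot : r.level k ≠ ⊥) (hsec : ¬ r.IsPrimary k) :
    ∃ u ≤ r.offlineMoves σ k, dist (σ.posAfter s u) (r.point k) ≤ (r.level k).pow / 8 ∧
      (∀ T : RTree X, (∀ i, u ≤ i → i ≤ r.offlineMoves σ k → σ.posAfter s i ∈ T.points) →
        (r.level k).pow / 64 ≤ T.cost) ∧
      ∀ k₁ < k, r.level k₁ = r.level k → dist (r.point k₁) (r.point k) ≤ (r.level k).pow / 2 →
        r.offlineMoves σ k₁ ≤ u := by
  classical
  have hadj : r.level k = (r.trigger k).level + ((3 : ℤ) : Level) := by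
    rw [level, serviceLevel, not_not.1 hsec]
  have hne : (r.trigger k).level ≠ ⊥ := (WithBot.add_ne_bot.1 (hadj ▸ hbot)).1
  obtain ⟨k₀, hk₀, hlev₀, hrel₀, hdist₀, hcost₀, hchosen⟩ :=
    exists_origin hk.le (trigger_mem hk) hne
  have hk₀' : k₀ < r.length := hk₀.trans hk
  have hpow : (r.level k).pow = 16 * (r.level k₀).pow := by
    rw [hadj, ← hlev₀, Level.pow_add_coe, Level.pow_add_coe]; norm_num; ring
  have hV : 0 < (r.level k).pow := by
    obtain ⟨m, hm⟩ := WithBot.ne_bot_iff_exists.1 hbot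
    rw [← hm, Level.pow_coe]
    positivity
  have hle₀ : r.level k₀ ≤ r.level k :=
    (Level.le_add_coe _ zero_le_one).trans (hlev₀.le.trans (r.level_trigger_le k))
  -- The walk starts where the first of the chosen requests is served.
  have hserve : ∀ x ∈ r.chosen k₀, ∃ i, i ≤ r.offlineMoves σ k ∧ σ.posAfter s i = x ∧
      ∃ j ∈ (r.state k₀).jobs, j.IsEligible (r.pos k₀) (r.time k₀) (r.level k₀) ∧
        j.req.point = x ∧ ∀ t < j.req.release, σ.numMoves t ≤ i := by
    intro x hx
    obtain ⟨j, hj, helig, hpt, hdl⟩ := hchosen x hx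
    obtain ⟨i, hi, hpi, hrel⟩ := (hσ.2 _ (req_mem hk₀'.le hj)).exists_posAfter
    exact ⟨i, hi.trans (σ.numMoves_mono hdl), hpi.trans hpt, j, hj, helig, hpt, hrel⟩
  have hex : ∃ i, ∃ x ∈ r.chosen k₀, i ≤ r.offlineMoves σ k ∧ σ.posAfter s i = x ∧
      ∃ j ∈ (r.state k₀).jobs, j.IsEligible (r.pos k₀) (r.time k₀) (r.level k₀) ∧
        j.req.point = x ∧ ∀ t < j.req.release, σ.numMoves t ≤ i := by
    obtain ⟨i, h⟩ := hserve _ (trigger_mem_serviceChoice _ _ _)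
    exact ⟨i, _, trigger_mem_serviceChoice _ _ _, h⟩
  obtain ⟨x, hx, hu, hpu, j, hj, helig, hpt, hrel⟩ := Nat.find_spec hex
  set u := Nat.find hex
  obtain ⟨-, hjlev, hjdist⟩ := Job.isEligible_iff.1 helig
  have hxk : dist x (r.point k) ≤ (r.level k).pow / 8 := by
    have h1 : dist (r.pos k₀) (r.point k) ≤ (r.level k₀).pow := hdist₀
    rw [hpt] at hjdist
    linarith [dist_triangle_left x (r.point k) (r.pos k₀)]
  refine ⟨u, hu, by rwa [hpu], fun T hT => ?_, fun k₁ hk₁ hlev hd => hrel _ ?_⟩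
  · have hsub : r.chosen k₀ ⊆ T.points := by
      intro y hy
      obtain ⟨i, hi, hpi, h⟩ := hserve y hy
      rw [← hpi]
      exact hT i (Nat.find_min' hex ⟨y, hy, hi, hpi, h⟩) hi
    have := (hST (r.chosen k₀) (r.point k₀) (trigger_mem_serviceChoice _ _ _)).2.2 T hsub
    linarith
  · rcases lt_trichotomy k₁ k₀ with hlt | rfl | hgt
    · refine time_lt_release hlt hk₀'.le hj (hlev ▸ hbot) (hlev ▸ hjlev.trans hle₀) ?_
      rw [hlev, hpt]
      rw [dist_comm] at hxk
      linarith [dist_triangle (r.point k₁) (r.point k) x]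
    · rw [hlev] at hpow
      linarith
    · -- The trigger of service `k` would have been eligible in service `k₁`.
      have := time_lt_release hk₁ hk.le (trigger_mem hk) (hlev ▸ hbot)
        (hlev ▸ r.level_trigger_le k) (by
          change dist (r.point k₁) (r.point k) ≤ _
          rw [hlev]
          linarith)
      exact absurd (hrel₀.trans (time_mono hgt.le (hk₁.trans hk))) (not_le.2 this)

variable [Fintype X]

open Classical in
/-- The charged services cost `O(log n)` times as much as the offline solution. -/
lemma sum_charged_le (hST : ST.IsTwoApprox) (hσ : Schedule.IsFeasible s I σ) :
    ∑ k ∈ Finset.range r.length with r.IsCharged σ k, (r.level k).pow ≤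
      128 * (9 + Nat.clog 2 (Fintype.card X)) * Schedule.cost s σ := by
  have hstart : ∀ k, k < r.length → r.IsCharged σ k → ∃ u ≤ r.offlineMoves σ k,
      dist (σ.posAfter s u) (r.point k) ≤ (r.level k).pow / 8 ∧
      (∀ T : RTree X, (∀ i, u ≤ i → i ≤ r.offlineMoves σ k → σ.posAfter s i ∈ T.points) →
        (r.level k).pow / 64 ≤ T.cost) ∧
      ∀ k₁ < k, r.level k₁ = r.level k → dist (r.point k₁) (r.point k) ≤ (r.level k).pow / 2 →
        r.offlineMoves σ k₁ ≤ u := by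
    intro k hk ⟨hbot, h⟩
    by_cases hp : r.IsPrimary k
    · exact exists_start_of_isPrimary hσ hk hbot (h hp)
    · exact exists_start_of_not_isPrimary hST hσ hk hbot hp
  choose! u hu hpu htree hearly using hstart
  have hlev : ∀ k, r.IsCharged σ k → r.level k = ((r.level k).unbotD 0 : ℤ) := fun k h => by
    obtain ⟨m, hm⟩ := WithBot.ne_bot_iff_exists.1 h.1
    rw [← hm, WithBot.unbotD_coe]
  have hpow : ∀ k, r.IsCharged σ k → (r.level k).pow = (2 : ℝ) ^ ((r.level k).unbotD 0) :=
    fun k h => by conv_lhs => rw [hlev k h, Level.pow_coe]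
  rw [← Schedule.sum_dist_posAfter, Finset.sum_congr rfl
    fun k hk => hpow k (Finset.mem_filter.1 hk).2]
  refine sum_zpow_le_of_disjoint _ (fun _ => dist_nonneg)
    (box := fun k => {i ∈ Finset.Ico (u k) (r.offlineMoves σ k) |
      dist (σ.posAfter s i) (r.point k) ≤ 2 ^ ((r.level k).unbotD 0) / 4}) ?_ ?_ ?_
  · intro k _ i hi
    have h1 := (Finset.mem_Ico.1 (Finset.mem_filter.1 hi).1).2
    exact Finset.mem_range.2 (h1.trans_le (σ.numMoves_le_length _))
  · intro k hk k' hk' hlt heq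
    obtain ⟨hk, hc⟩ := Finset.mem_filter.1 hk
    obtain ⟨hk', hc'⟩ := Finset.mem_filter.1 hk'
    rw [Finset.disjoint_left]
    intro i hi hi'
    obtain ⟨h1, h2⟩ := Finset.mem_filter.1 hi
    obtain ⟨h1', h2'⟩ := Finset.mem_filter.1 hi'
    rw [← hpow k hc] at h2
    rw [← hpow k' hc'] at h2'
    have hll : r.level k = r.level k' := by rw [hlev k hc, hlev k' hc', heq]
    have h3 := hearly k' (Finset.mem_range.1 hk') hc' k hlt hll (by
      rw [hll] at h2
      linarith [dist_triangle_left (r.point k) (r.point k') (σ.posAfter s i)])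
    have h4 := (Finset.mem_Ico.1 h1).2
    have h5 := (Finset.mem_Ico.1 h1').1
    omega
  · intro k hk
    obtain ⟨hk, hc⟩ := Finset.mem_filter.1 hk
    rw [Finset.mem_range] at hk
    have h1 := hpu k hk hc
    have h2 := htree k hk hc
    rw [hpow k hc] at h1 h2
    exact le_sum_moveWeight_ball _ (hu k hk hc) h1 h2

omit [Fintype X] in
open Classical in
/-- The potential is the distance between the two servers.  A primary service that is not charged
lowers it by `2 ^ L / 32`, a charged one raises it by at most `2 ^ L / 8`. -/
lemma sum_not_charged_add_dist_le {k : ℕ} (hk : k ≤ r.length) {c : ℕ → ℕ} (hc0 : c 0 = 0)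
    (hc : ∀ i, c (i + 1) = r.offlineMoves σ i) :
    ∑ i ∈ Finset.range k,
        (if r.IsPrimary i ∧ ¬ r.IsCharged σ i then (r.level i).pow / 32 else 0) +
      dist (r.pos k) (σ.posAfter s (c k)) ≤
    ∑ i ∈ Finset.range k, (if r.IsCharged σ i then (r.level i).pow / 8 else 0) +
      ∑ i ∈ Finset.range (c k), dist (σ.posAfter s i) (σ.posAfter s (i + 1)) := by
  induction k with
  | zero =>
    have : r.pos 0 = s := by rw [pos, r.state_zero]; rfl
    simp [hc0, this]
  | succ k ih =>
    have ih := ih (Nat.le_of_succ_le hk)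
    have hmono : c k ≤ c (k + 1) := by
      rcases k with _ | k
      · omega
      · rw [hc, hc]
        exact σ.numMoves_mono (time_mono k.le_succ hk)
    have h1 := dist_le_Ico_sum_dist (σ.posAfter s) hmono
    have h2 := Finset.sum_range_add_sum_Ico
      (fun i => dist (σ.posAfter s i) (σ.posAfter s (i + 1))) hmono
    have h3 := dist_triangle (r.pos k) (σ.posAfter s (c k)) (σ.posAfter s (c (k + 1)))
    suffices h : (if r.IsPrimary k ∧ ¬ r.IsCharged σ k then (r.level k).pow / 32 else 0) +
        dist (r.pos (k + 1)) (σ.posAfter s (c (k + 1))) ≤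
        (if r.IsCharged σ k then (r.level k).pow / 8 else 0) +
          dist (r.pos k) (σ.posAfter s (c (k + 1))) by
      rw [Finset.sum_range_succ, Finset.sum_range_succ]
      linarith
    have hV := (r.level k).pow_nonneg
    by_cases hp : r.IsPrimary k
    · rw [pos_succ_of_isPrimary hk hp]
      have h4 := r.dist_pos_point_le k
      have h5 := hp.lt_dist
      by_cases hch : r.IsCharged σ k
      · simp only [hp, hch, not_true, and_false, if_true, if_false]
        linarith [dist_triangle_left (r.point k) (σ.posAfter s (c (k + 1))) (r.pos k)]
      · have hnear : ¬ r.IsFar σ k := fun h => hch ⟨hp.level_ne_bot, fun _ => h⟩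
        rw [IsFar, not_lt, ← hc, dist_comm] at hnear
        simp only [hp, hch, not_false_eq_true, and_true, if_true, if_false]
        linarith [dist_triangle_right (r.pos k) (r.point k) (σ.posAfter s (c (k + 1)))]
    · rw [pos_succ_of_not_isPrimary hk hp]
      simp only [hp, false_and, if_false, zero_add]
      split_ifs <;> linarith

open Classical in
lemma sum_pow_level_le (hST : ST.IsTwoApprox) (hσ : Schedule.IsFeasible s I σ) :
    ∑ k ∈ Finset.range r.length, (r.level k).pow ≤
      (640 * (9 + Nat.clog 2 (Fintype.card X)) + 32) * Schedule.cost s σ := by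
  have hcharged := r.sum_charged_le hST hσ
  set B := ∑ k ∈ Finset.range r.length with r.IsCharged σ k, (r.level k).pow with hB
  have hpot := r.sum_not_charged_add_dist_le (σ := σ) le_rfl
    (c := fun k => k.casesOn 0 fun i => r.offlineMoves σ i) rfl fun _ => rfl
  set c : ℕ := (r.length.casesOn 0 fun i => r.offlineMoves σ i : ℕ) with hc
  have hcl : c ≤ σ.length := by
    rw [hc]
    cases r.length
    · exact Nat.zero_le _
    · exact σ.numMoves_le_length _
  have hmoves : ∑ i ∈ Finset.range c, dist (σ.posAfter s i) (σ.posAfter s (i + 1)) ≤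
      Schedule.cost s σ := by
    rw [← Schedule.sum_dist_posAfter]
    exact Finset.sum_le_sum_of_subset_of_nonneg (Finset.range_subset_range.2 hcl)
      fun _ _ _ => dist_nonneg
  have hG : ∑ k ∈ Finset.range r.length,
      (if r.IsPrimary k ∧ ¬ r.IsCharged σ k then (r.level k).pow / 32 else 0) ≤
      B / 8 + Schedule.cost s σ := by
    have h1 : ∑ k ∈ Finset.range r.length, (if r.IsCharged σ k then (r.level k).pow / 8 else 0) =
        B / 8 := by
      rw [hB, Finset.sum_div, Finset.sum_filter]
    have h2 := dist_nonneg (x := r.pos r.length) (y := σ.posAfter s c)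
    linarith
  -- A service that is neither charged nor primary has level `-∞`.
  have hsplit : ∑ k ∈ Finset.range r.length, (r.level k).pow ≤ B + 32 *
      ∑ k ∈ Finset.range r.length,
        (if r.IsPrimary k ∧ ¬ r.IsCharged σ k then (r.level k).pow / 32 else 0) := by
    rw [hB, Finset.sum_filter, Finset.mul_sum, ← Finset.sum_add_distrib]
    refine Finset.sum_le_sum fun k _ => ?_
    by_cases hch : r.IsCharged σ k
    · simp [hch]
    · by_cases hp : r.IsPrimary k
      · simp only [hch, hp, not_false_eq_true, and_self, if_true, if_false]
        linarith
      · have : r.level k = ⊥ := by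
          by_contra h
          exact hch ⟨h, fun h' => absurd h' hp⟩
        simp [this]
  linarith

end Offline

end Run

/-! ### The competitive ratio -/

section Competitive

variable [Fintype X] [MetricSpace X] {ST : SteinerProcedure X}

lemma cost_serviceAlgorithm_le (hST : ST.IsTwoApprox) {s : X} {I : Instance X} {σ : Schedule X}
    (hσ : Schedule.IsFeasible s I σ) :
    Schedule.cost s (serviceAlgorithm ST s I) ≤
      23 * (640 * (9 + Nat.clog 2 (Fintype.card X)) + 32) * Schedule.cost s σ := by
  obtain ⟨r, hr⟩ := exists_run ST s I
  rw [← hr]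
  have h1 := Run.cost_moves_le (r := r) hST le_rfl
  have h2 := r.sum_pow_level_le hST hσ
  linarith

omit [Fintype X] in
lemma walkLength_nonneg (s : X) (l : List X) : 0 ≤ walkLength s l := by
  induction l generalizing s with
  | nil => exact le_rfl
  | cons x l ih => exact add_nonneg dist_nonneg (ih x)

omit [Fintype X] in
lemma walkLength_of_subsingleton [Subsingleton X] (s : X) (l : List X) : walkLength s l = 0 := by
  induction l generalizing s with
  | nil => rfl
  | cons x l ih => rw [walkLength, ih, Subsingleton.elim s x, dist_self, zero_add]

lemma nine_add_clog_le {n : ℕ} (hn : 2 ≤ n) : 9 + (Nat.clog 2 n : ℝ) ≤ 16 * Real.log n := by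
  have hlog : (Nat.clog 2 n : ℝ) - 1 ≤ Real.log n / Real.log 2 := by
    have h1 : 2 ^ (Nat.clog 2 n).pred < n := Nat.pow_pred_clog_lt_self one_lt_two hn
    have h2 : 1 ≤ Nat.clog 2 n := Nat.clog_pos one_lt_two hn
    rw [le_div_iff₀ (Real.log_pos one_lt_two)]
    have h3 : ((Nat.clog 2 n : ℝ) - 1) = ((Nat.clog 2 n).pred : ℕ) := by
      rw [Nat.pred_eq_sub_one, Nat.cast_sub h2]; simp
    rw [h3, ← Real.log_pow]
    exact Real.log_le_log (by positivity) (by exact_mod_cast h1.le)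
  have h2 := Real.log_two_gt_d9
  have h4 : Real.log 2 ≤ Real.log n := Real.log_le_log two_pos (by exact_mod_cast hn)
  have h5 : Real.log n / Real.log 2 ≤ Real.log n * 1.45 := by
    rw [div_le_iff₀ (by linarith)]
    nlinarith
  linarith

lemma isCompetitive_serviceAlgorithm (hST : ST.IsTwoApprox) :
    (serviceAlgorithm ST).IsCompetitive (247296 * Real.log (Fintype.card X)) := by
  refine fun s I => ⟨isFeasible_serviceAlgorithm hST s I, fun σ hσ => ?_⟩
  rcases subsingleton_or_nontrivial X with hX | hX
  · simp only [Schedule.cost, walkLength_of_subsingleton, mul_zero, le_refl]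
  · refine (cost_serviceAlgorithm_le hST hσ).trans ?_
    have h1 := nine_add_clog_le (Fintype.one_lt_card (α := X))
    have h2 : (0 : ℝ) ≤ Nat.clog 2 (Fintype.card X) := Nat.cast_nonneg _
    refine mul_le_mul_of_nonneg_right ?_ (walkLength_nonneg _ _)
    linarith

end Competitive

end OnlineService

theorem theorem3p1 :
    ∃ C : ℝ, ∀ (X : Type*) [Fintype X] [MetricSpace X],
      (∃ A : OnlineService.Algorithm X, A.IsOnline ∧
        A.IsCompetitive (C * Real.log (Fintype.card X))) ∧
      (∀ ST : OnlineService.SteinerProcedure X, ST.IsTwoApprox →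
        (OnlineService.serviceAlgorithm ST).IsOnline ∧
        (OnlineService.serviceAlgorithm ST).IsCompetitive
          (C * Real.log (Fintype.card X))) := by
  refine ⟨247296, fun X _ _ => ?_⟩
  have h : ∀ ST : OnlineService.SteinerProcedure X, ST.IsTwoApprox →
      (OnlineService.serviceAlgorithm ST).IsOnline ∧
      (OnlineService.serviceAlgorithm ST).IsCompetitive
        (247296 * Real.log (Fintype.card X)) := fun ST hST =>
    ⟨OnlineService.isOnline_serviceAlgorithm ST,
      OnlineService.isCompetitive_serviceAlgorithm hST⟩
  obtain ⟨ST, hST⟩ := OnlineService.exists_isTwoApprox (X := X)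
  exact ⟨⟨_, h ST hST⟩, h⟩
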